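/- Let $L_2$ be the space of square integrable $1$-periodic complex-valued functions, $\widehat f(n)=\int_0^1 f(x)e^{-2\pi i n x}\,dx$ for $n\in\mathbb Z$, $S^k_jf=f(\cdot+2^{-j}k)$, and let $R_j$ be the set of integers $k$ with $-2^{j-1}<k\le 2^{j-1}$. For $j\ge 0$ fix an integer $\rho_j\ge 1$. Let $\varphi_j\in L_2$ ($j\ge1$) and $\psi^m_j\in L_2$ ($j\ge 0$, $1\le m\le\rho_j$) satisfy, for all $n\in\mathbb Z$, $$\widehat{\varphi_j}(n)=\sqrt2\,\widehat{a_{j+1}}(n)\,\widehat{\varphi_{j+1}}(n)\quad(j\ge1),\qquad \widehat{\psi^m_j}(n)=\sqrt2\,\widehat{b^m_{j+1}}(n)\,\widehat{\varphi_{j+1}}(n)\quad(j\ge0,\ 1\le m\le\rho_j),$$ where $\widehat{a_{j+1}}$ and $\widehat{b^m_{j+1}}$ are $2^{j+1}$-periodic complex sequences on $\mathbb Z$. Put $B_j(n)=\sum_{m=1}^{\rho_{j-1}}|\widehat{b^m_j}(n)|^2$ for $j\ge 1$, and define $\theta_1(n)=B_1(n)$ and $\theta_{j+1}(n)=B_{j+1}(n)+\theta_j(n)|\widehat{a_{j+1}}(n)|^2$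 for $j\ge1$. For $n\in\mathbb Z$ let $$j_0(n)+1=\min\{j\ge1:\widehat{\varphi_j}(n)\ne0\},\qquad j_1(n)=\min\{j\ge1:\widehat{\varphi_j}(n)\neq0\ \text{and}\ B_j(n)\ne0\}$$ whenever the respective set is nonempty. For real numbers $t_r(j,n)$ ($j\ge2$, $n\in\mathbb Z$, $1\le r\le 2\rho_{j-1}+1$) that are $2^j$-periodic in $n$ put, writing $t_r=t_r(j,n)$, $$\tilde a_j(n)=\Big(\prod_{r=1}^{\rho_{j-1}}\cos t_r\Big)e^{it_{\rho_{j-1}+1}},\qquad \tilde b^m_j(n)=\Big(\prod_{r=m+1}^{\rho_{j-1}}\cos t_r\Big)\sin t_m\,e^{it_{\rho_{j-1}+1+m}}\quad(1\le m\le\rho_{j-1}).$$ Then $\{S^k_j\psi^m_j: j\ge0,\ 1\le m\le\rho_j,\ k\in R_j\}$ is a Parseval frame of $L_2$, i.e. $\|f\|_2^2=\sum_{j\ge0}\sum_{m=1}^{\rho_j}\sum_{k\in R_j}|\langle f,S^k_j\psi^m_j\rangle|^2$ for all $f\in L_2$, if and only if the following condition (1) holds and there are parameters $t_r(j,n)$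 as above satisfying (i), (ii) and, for every $n\in\mathbb Z$, (2) and (3), where $j_0=j_0(n)$ and $j_1=j_1(n)$. (1) For every $n\in\mathbb Z$ the set $\{j\ge1:\widehat{\varphi_j}(n)\neq0\}\cap\{j\ge1:B_j(n)\ne0\}$ is nonempty. (i) For all $j\ge2$ and $n\in\mathbb Z$ with $\theta_j(n)\ne0$ and $\theta_j(n+2^{j-1})\neq0$, the numbers $t^0_r=t_r(j,n)$ and $t^1_r=t_r(j,n+2^{j-1})$ satisfy $$\sum_{m=0}^{\rho_{j-1}}\cos\big(t^0_{\rho_{j-1}+1+m}-t^1_{\rho_{j-1}+1+m}\big)\prod_{k=0}^1\Big(\sin t^k_m\prod_{r=m+1}^{\rho_{j-1}}\cos t^k_r\Big)=0$$ and the same equation with $\cos\big(t^0_{\rho_{j-1}+1+m}-t^1_{\rho_{j-1}+1+m}\big)$ replaced by $\sin\big(t^0_{\rho_{j-1}+1+m}-t^1_{\rho_{j-1}+1+m}\big)$; here $\sin t^k_0$ is read as $1$. If $\theta_j(n)=0$ or $\theta_j(n+2^{j-1})=0$, no relation between them is required. (ii) For all $n\in\mathbb Z$ and $j>j_1(n)$: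 $\tilde a_j(n)\neq0$, and $\tilde a_j(n)$ is a positive real multiple of $\widehat{a_j}(n)$. (2) $\displaystyle\prod_{r=j_1+1}^\infty|\tilde a_r(n)|^2=2^{j_1}\,B_{j_1}(n)\,|\widehat{\varphi_{j_1}}(n)|^2$. (3) The numbers $\widehat{b^m_j}(n)$, $1\le m\le\rho_{j-1}$, are: (a) arbitrary for $1\le j\le j_0$; (b) $0$ for $j_0+1\le j\le j_1-1$; (c) for $j=j_1$, such that $\sum_{m=1}^{\rho_{j_1-1}}\overline{\widehat{b^m_{j_1}}(n)}\,\widehat{b^m_{j_1}}(n+2^{j_1-1})=0$, unless $\widehat{\varphi_{j_1}}(n+2^{j_1-1}k)=0$ for all odd integers $k$; (d) given by $\displaystyle\widehat{b^m_j}(n)=\tilde b^m_j(n)\,\sqrt{B_{j_1}(n)}\prod_{r=j_1+1}^j\frac{|\widehat{a_r}(n)|}{|\tilde a_r(n)|}$ for $j>j_1$. -/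

import Mathlib

open MeasureTheory Filter Topology Finset

noncomputable section

namespace PeriodicWavelet

/-- The space `L_2` of square integrable 1-periodic complex-valued functions. -/
abbrev L2 : Type := Lp ℂ 2 (AddCircle.haarAddCircle : Measure UnitAddCircle)

/-- The shift `S^k_j f = f(· + 2^{-j} k)` on `L_2`. -/
def shift (j : ℕ) (k : ℤ) (f : L2) : L2 :=
  Lp.compMeasurePreserving
    (fun x : UnitAddCircle => x + (((k : ℝ) / 2 ^ j : ℝ) : UnitAddCircle))
    (measurePreserving_add_right AddCircle.haarAddCircle _) f

/-- `R_j`: the integers `k` with `-2^{j-1} < k ≤ 2^{j-1}` (so `R_0 = {0}`). -/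
def shiftIndex (j : ℕ) : Finset ℤ :=
  (Finset.Icc (-(2 : ℤ) ^ j) (2 ^ j)).filter (fun k => -(2 : ℤ) ^ j < 2 * k ∧ 2 * k ≤ 2 ^ j)

/-- The wavelet system `{S^k_j ψ^m_j : j ≥ 0, 1 ≤ m ≤ ρ_j, k ∈ R_j}` is a Parseval frame:
`‖f‖² = ∑_j ∑_m ∑_k |⟨f, S^k_j ψ^m_j⟩|²` for every `f ∈ L_2`. -/
def IsParsevalWaveletFrame (ρ : ℕ → ℕ) (ψ : ℕ → ℕ → L2) : Prop :=
  ∀ f : L2, HasSum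
    (fun j : ℕ => ∑ m ∈ Finset.Icc 1 (ρ j), ∑ k ∈ shiftIndex j,
      ‖inner ℂ (shift j k (ψ j m)) f‖ ^ 2)
    (‖f‖ ^ 2)

/-- `∑_{m=1}^{ρ_{j-1}} |b^m_j(n)|²`, for `j ≥ 1`. -/
def maskEnergy (ρ : ℕ → ℕ) (b : ℕ → ℕ → ℤ → ℂ) (j : ℕ) (n : ℤ) : ℝ :=
  ∑ m ∈ Finset.Icc 1 (ρ (j - 1)), ‖b j m n‖ ^ 2

/-- The fundamental coefficients `θ_j(n)`. As `θ_0 = 0`, the value `a 1` plays no role. -/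
def theta (ρ : ℕ → ℕ) (a : ℕ → ℤ → ℂ) (b : ℕ → ℕ → ℤ → ℂ) : ℕ → ℤ → ℝ
  | 0, _ => 0
  | j + 1, n => maskEnergy ρ b (j + 1) n + theta ρ a b j n * ‖a (j + 1) n‖ ^ 2

/-- `j_0(n)`, given by `j_0(n) + 1 = min {j ≥ 1 : φ̂_j(n) ≠ 0}`. -/
def level0 (φ : ℕ → L2) (n : ℤ) : ℕ :=
  sInf {j : ℕ | fourierCoeff (φ (j + 1)) n ≠ 0}

/-- `{j ≥ 1 : φ̂_j(n) ≠ 0} ∩ {j ≥ 1 : ∑_m |b^m_j(n)|² ≠ 0}`. -/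
def activeLevels (ρ : ℕ → ℕ) (φ : ℕ → L2) (b : ℕ → ℕ → ℤ → ℂ) (n : ℤ) : Set ℕ :=
  {j : ℕ | 1 ≤ j ∧ fourierCoeff (φ j) n ≠ 0} ∩ {j : ℕ | 1 ≤ j ∧ maskEnergy ρ b j n ≠ 0}

/-- `j_1(n)`, the minimum of `activeLevels` (used only when that set is nonempty). -/
def level1 (ρ : ℕ → ℕ) (φ : ℕ → L2) (b : ℕ → ℕ → ℤ → ℂ) (n : ℤ) : ℕ :=
  sInf (activeLevels ρ φ b n)

/-- `sin s_m · ∏_{r=m+1}^{N} cos s_r`, where for `m = 0` the sine factor is absent. -/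
def sphericalFactor (N : ℕ) (s : ℕ → ℝ) (m : ℕ) : ℝ :=
  (if m = 0 then 1 else Real.sin (s m)) * ∏ r ∈ Finset.Icc (m + 1) N, Real.cos (s r)

/-- The auxiliary coefficient
`ã_j(n) = (∏_{r=1}^{ρ_{j-1}} cos t_r) e^{i t_{ρ_{j-1}+1}}`, `t_r = t_r(j, n)`. -/
def aTilde (ρ : ℕ → ℕ) (t : ℕ → ℤ → ℕ → ℝ) (j : ℕ) (n : ℤ) : ℂ :=
  (sphericalFactor (ρ (j - 1)) (t j n) 0 : ℂ) *
    Complex.exp (Complex.I * (t j n (ρ (j - 1) + 1) : ℂ))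

/-- The auxiliary coefficient
`b̃^m_j(n) = (∏_{r=m+1}^{ρ_{j-1}} cos t_r) sin t_m e^{i t_{ρ_{j-1}+1+m}}`, `m ≥ 1`. -/
def bTilde (ρ : ℕ → ℕ) (t : ℕ → ℤ → ℕ → ℝ) (j m : ℕ) (n : ℤ) : ℂ :=
  (sphericalFactor (ρ (j - 1)) (t j n) m : ℂ) *
    Complex.exp (Complex.I * (t j n (ρ (j - 1) + 1 + m) : ℂ))

/-- The pair of real trigonometric equations linking the parameters `s⁰` and `s¹`
(each with indices `1, …, 2N+1`) attached to `n` and to `n + 2^{j-1}`; here `N = ρ_{j-1}`. -/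
def LinkingSystem (N : ℕ) (s₀ s₁ : ℕ → ℝ) : Prop :=
  (∑ m ∈ Finset.Icc 0 N, Real.cos (s₀ (N + 1 + m) - s₁ (N + 1 + m)) *
      (sphericalFactor N s₀ m * sphericalFactor N s₁ m) = 0) ∧
  (∑ m ∈ Finset.Icc 0 N, Real.sin (s₀ (N + 1 + m) - s₁ (N + 1 + m)) *
      (sphericalFactor N s₀ m * sphericalFactor N s₁ m) = 0)

/-- Admissible parameters `t_r(j, n)`, `j ≥ 2`: they depend on `n` modulo `2^j`; the parameters at
`n` and `n + 2^{j-1}` are linked unless one of the two fundamental coefficients vanishes; and at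
every level above `j_1(n)` the coefficient `ã_j(n)` is nonzero and is a positive multiple of the
scaling mask `a_j(n)`. -/
structure AdmissibleParameters (ρ : ℕ → ℕ) (φ : ℕ → L2) (a : ℕ → ℤ → ℂ) (b : ℕ → ℕ → ℤ → ℂ)
    (t : ℕ → ℤ → ℕ → ℝ) : Prop where
  periodic : ∀ j : ℕ, 2 ≤ j → Function.Periodic (t j) ((2 : ℤ) ^ j)
  linked : ∀ j : ℕ, 2 ≤ j → ∀ n : ℤ,
    theta ρ a b j n ≠ 0 → theta ρ a b j (n + 2 ^ (j - 1)) ≠ 0 →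
      LinkingSystem (ρ (j - 1)) (t j n) (t j (n + 2 ^ (j - 1)))
  aligned : ∀ (n : ℤ) (j : ℕ), level1 ρ φ b n < j →
    2 ≤ j → aTilde ρ t j n ≠ 0 ∧ ∃ c : ℝ, 0 < c ∧ aTilde ρ t j n = (c : ℂ) * a j n

/-- The infinite product `∏_{r=j_1+1}^∞ |ã_r(n)|²` converges to
`2^{j_1} ∑_m |b^m_{j_1}(n)|² |φ̂_{j_1}(n)|²`. -/
def ProductCondition (ρ : ℕ → ℕ) (φ : ℕ → L2) (b : ℕ → ℕ → ℤ → ℂ)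
    (t : ℕ → ℤ → ℕ → ℝ) (n : ℤ) : Prop :=
  Tendsto (fun N : ℕ => ∏ r ∈ Finset.Ioc (level1 ρ φ b n) N, ‖aTilde ρ t r n‖ ^ 2) atTop
    (𝓝 (2 ^ level1 ρ φ b n * maskEnergy ρ b (level1 ρ φ b n) n *
      ‖fourierCoeff (φ (level1 ρ φ b n)) n‖ ^ 2))

/-- The description of the masks `b^m_j(n)`, level by level. For `1 ≤ j ≤ j_0(n)` they are
arbitrary, so there is no clause for these levels. -/
structure MaskCondition (ρ : ℕ → ℕ) (φ : ℕ → L2) (a : ℕ → ℤ → ℂ) (b : ℕ → ℕ → ℤ → ℂ)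
    (t : ℕ → ℤ → ℕ → ℝ) (n : ℤ) : Prop where
  zero : ∀ j : ℕ, level0 φ n + 1 ≤ j → j < level1 ρ φ b n →
    ∀ m ∈ Finset.Icc 1 (ρ (j - 1)), b j m n = 0
  orthogonal :
    (∃ k : ℤ, Odd k ∧
      fourierCoeff (φ (level1 ρ φ b n)) (n + 2 ^ (level1 ρ φ b n - 1) * k) ≠ 0) →
    ∑ m ∈ Finset.Icc 1 (ρ (level1 ρ φ b n - 1)),
      (starRingEnd ℂ) (b (level1 ρ φ b n) m n) *
        b (level1 ρ φ b n) m (n + 2 ^ (level1 ρ φ b n - 1)) = 0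
  formula : ∀ j : ℕ, level1 ρ φ b n < j → ∀ m ∈ Finset.Icc 1 (ρ (j - 1)),
    b j m n = bTilde ρ t j m n *
      ((√(maskEnergy ρ b (level1 ρ φ b n) n) *
        ∏ r ∈ Finset.Ioc (level1 ρ φ b n) j, ‖a r n‖ / ‖aTilde ρ t r n‖ : ℝ) : ℂ)

end PeriodicWavelet

end

/-!
In the Fourier basis the frame operator of the levels `j < J` has matrix `frameKernel`, because
summing over the shifts `k ∈ R_j` is orthogonality of the characters of `ℤ / 2^j`. By polarization
on trigonometric polynomials, and a density argument, the system is a Parseval frame iff every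
entry of this matrix tends to the corresponding entry of the identity
(`isParsevalWaveletFrame_iff_kernel`).

The refinement equations make the entries telescope. The diagonal entry at `n` is
`2^J θ_J(n) |φ̂_J(n)|²`. If `2^j` is the exact power of two dividing `n' - n ≠ 0`, the entry at
`(n, n')` is constant for `J > j` and is a multiple of the Hermitian product of the mask vectors
`(√θ_j a_{j+1}, b^1_{j+1}, …)` at `n` and at `n + 2^j`. So the Parseval property means that
`2^J θ_J |φ̂_J|² → 1`, and that these products vanish wherever the scaling functions see both
frequencies (`RefinementSystem.isParsevalWaveletFrame_iff`).

The mask vector of level `j + 1` has squared norm `θ_{j+1}`, which is positive at and above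
`j_1(n)`. Above `j_1(n)` the numbers `ã`, `b̃^m` are the components of the normalised mask vector,
and `t` are its spherical coordinates; conversely, alignment of `ã` with `a` and the formula for
`b^m` force `√θ_j = √B_{j_1} ∏ |a_r| / |ã_r|` and so this representation
(`RefinementSystem.representsMasks_of_formula`). The product condition then becomes the limit above
(`RefinementSystem.productCondition_iff_of_represents`), and the linking equations become
orthogonality of the vectors at `n` and `n + 2^j`. The linking equations also concern residue
classes in which no frequency is above its level `j_1`; there the parameters are free, and as
`ρ_j + 1 ≥ 2` an orthogonal vector is available (`exists_linked`).
If `j + 1 ≤ j_1(n)` and `φ̂_{j+1}(n) ≠ 0`, then `θ_j a_{j+1}` vanishes at `n`, so orthogonality only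
concerns the `b^m`.
-/

namespace PeriodicWavelet

open scoped ComplexConjugate

/-! ### Fourier coefficients of the shifted generators -/

theorem fourierCoeff_shift (j : ℕ) (k : ℤ) (f : L2) (n : ℤ) :
    fourierCoeff (shift j k f) n =
      fourier n (((k : ℝ) / 2 ^ j : ℝ) : UnitAddCircle) * fourierCoeff f n := by
  set x : UnitAddCircle := (((k : ℝ) / 2 ^ j : ℝ) : UnitAddCircle) with hx
  have h := Lp.coeFn_compMeasurePreserving f
    (measurePreserving_add_right (AddCircle.haarAddCircle : Measure UnitAddCircle) x)
  have h1 : fourierCoeff (shift j k f) n =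
      ∫ y : UnitAddCircle, fourier (-n) y • f (y + x) ∂AddCircle.haarAddCircle := by
    unfold fourierCoeff
    refine integral_congr_ae ?_
    filter_upwards [h] with y hy
    exact congrArg (fourier (-n) y • ·) hy
  have h2 : (fun y : UnitAddCircle => fourier (-n) y • f (y + x)) =
      fun y => (fun z : UnitAddCircle => fourier n x * (fourier (-n) z • f z)) (y + x) := by
    funext y
    have h3 : (fourier n x : ℂ) * fourier (-n) (y + x) = fourier (-n) y := by
      have h4 : (fourier n x : ℂ) * fourier (-n) x = 1 := by
        rw [← fourier_add, add_neg_cancel, fourier_zero]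
      simp only [fourier_apply, smul_add, AddCircle.toCircle_add, Circle.coe_mul] at h4 ⊢
      linear_combination (AddCircle.toCircle (-n • y) : ℂ) * h4
    simp only [smul_eq_mul, ← mul_assoc, h3]
  rw [h1, h2, integral_add_right_eq_self
    (fun z : UnitAddCircle => fourier n x * (fourier (-n) z • f z)) x, integral_const_mul]
  rfl

theorem inner_fourierLp_right (g : L2) (n : ℤ) :
    inner ℂ g (fourierLp 2 n) = conj (fourierCoeff g n) := by
  rw [← inner_conj_symm, ← fourierBasis_repr, HilbertBasis.repr_apply_apply, coe_fourierBasis]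

/-- `R_j` is a block of `2^j` consecutive integers. -/
theorem exists_shiftIndex_eq_image (j : ℕ) :
    ∃ s : ℤ, shiftIndex j = (range (2 ^ j)).image (fun i : ℕ => (i : ℤ) + s) := by
  have key : ∀ s : ℤ, (∀ k : ℤ, (-(2 : ℤ) ^ j < 2 * k ∧ 2 * k ≤ 2 ^ j) ↔
      (s ≤ k ∧ k < s + 2 ^ j)) →
      shiftIndex j = (range (2 ^ j)).image (fun i : ℕ => (i : ℤ) + s) := by
    intro s hs
    ext k
    have h2 : (0 : ℤ) < 2 ^ j := by positivity
    simp only [shiftIndex, mem_filter, hs, mem_Icc, mem_image, mem_range]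
    constructor
    · rintro ⟨-, h3, h4⟩
      refine ⟨(k - s).toNat, ?_, by omega⟩
      have : ((k - s).toNat : ℤ) < ((2 ^ j : ℕ) : ℤ) := by push_cast; omega
      exact_mod_cast this
    · rintro ⟨i, hi, rfl⟩
      have hi' : (i : ℤ) < 2 ^ j := by exact_mod_cast hi
      have h5 := (hs ((i : ℤ) + s)).2 ⟨by omega, by omega⟩
      exact ⟨⟨by omega, by omega⟩, by omega, by omega⟩
  rcases j with _ | j
  · exact ⟨0, key 0 fun k => by simp only [pow_zero]; omega⟩
  · exact ⟨1 - 2 ^ j, key _ fun k => by rw [pow_succ]; omega⟩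

/-- Orthogonality of the characters of `ℤ / 2^j`. -/
theorem sum_shiftIndex_fourier (j : ℕ) (d : ℤ) :
    ∑ k ∈ shiftIndex j, (fourier d (((k : ℝ) / 2 ^ j : ℝ) : UnitAddCircle) : ℂ) =
      if (2 : ℤ) ^ j ∣ d then 2 ^ j else 0 := by
  obtain ⟨s, hs⟩ := exists_shiftIndex_eq_image j
  have hN : (2 ^ j : ℕ) ≠ 0 := by positivity
  have hprim := Complex.isPrimitiveRoot_exp (2 ^ j) hN
  set ζ := Complex.exp (2 * Real.pi * Complex.I / (2 ^ j : ℕ)) with hζ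
  have hζ0 : ζ ≠ 0 := Complex.exp_ne_zero _
  have hterm : ∀ k : ℤ, (fourier d (((k : ℝ) / 2 ^ j : ℝ) : UnitAddCircle) : ℂ) =
      (ζ ^ d) ^ k := by
    intro k
    rw [fourier_coe_apply, ← zpow_mul, hζ, ← Complex.exp_int_mul]
    congr 1
    push_cast
    ring
  have hω : (ζ ^ d) ^ (2 ^ j) = 1 := by
    rw [← zpow_natCast, zpow_comm, zpow_natCast, hprim.pow_eq_one, one_zpow]
  have hω0 : ζ ^ d ≠ 0 := zpow_ne_zero _ hζ0
  rw [hs, sum_image (by intro x _ y _ h; simpa using h)]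
  simp only [hterm]
  by_cases hd : (2 : ℤ) ^ j ∣ d
  · have : ζ ^ d = 1 := (hprim.zpow_eq_one_iff_dvd d).2 (by exact_mod_cast hd)
    simp [this, hd]
  · have h1 : ζ ^ d ≠ 1 := fun h => hd (by exact_mod_cast (hprim.zpow_eq_one_iff_dvd d).1 h)
    rw [if_neg hd]
    simp only [zpow_add₀ hω0, zpow_natCast]
    rw [← sum_mul, geom_sum_eq h1, hω, sub_self, zero_div, zero_mul]

/-! ### The frame kernel -/

/-- The matrix, in the Fourier basis, of the frame operator of the levels `j < J`. -/
noncomputable def frameKernel (ρ : ℕ → ℕ) (ψ : ℕ → ℕ → L2) (J : ℕ) (n n' : ℤ) : ℂ :=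
  ∑ j ∈ range J, ∑ m ∈ Icc 1 (ρ j),
    if (2 : ℤ) ^ j ∣ n' - n then
      2 ^ j * (conj (fourierCoeff (ψ j m) n) * fourierCoeff (ψ j m) n') else 0

/-- The energy of `f` captured by the wavelets of the levels `j < J`. -/
noncomputable def partialEnergy (ρ : ℕ → ℕ) (ψ : ℕ → ℕ → L2) (J : ℕ) (f : L2) : ℝ :=
  ∑ j ∈ range J, ∑ m ∈ Icc 1 (ρ j), ∑ k ∈ shiftIndex j, ‖inner ℂ (shift j k (ψ j m)) f‖ ^ 2

theorem isParsevalWaveletFrame_iff_tendsto (ρ : ℕ → ℕ) (ψ : ℕ → ℕ → L2) :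
    IsParsevalWaveletFrame ρ ψ ↔
      ∀ f : L2, Tendsto (fun J => partialEnergy ρ ψ J f) atTop (𝓝 (‖f‖ ^ 2)) := by
  refine forall_congr' fun f => ?_
  rw [hasSum_iff_tendsto_nat_of_nonneg fun j => by positivity]
  rfl

theorem partialEnergy_monotone (ρ : ℕ → ℕ) (ψ : ℕ → ℕ → L2) (f : L2) :
    Monotone fun J => partialEnergy ρ ψ J f := by
  intro J J' h
  exact sum_le_sum_of_subset_of_nonneg (range_mono h) fun _ _ _ => by positivity

/-- On trigonometric polynomials the energy is the quadratic form of the frame kernel. -/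
theorem partialEnergy_trigPoly (ρ : ℕ → ℕ) (ψ : ℕ → ℕ → L2) (J : ℕ) (F : Finset ℤ) (c : ℤ → ℂ) :
    (partialEnergy ρ ψ J (∑ n ∈ F, c n • fourierLp 2 n) : ℂ) =
      ∑ n ∈ F, ∑ n' ∈ F, c n * conj (c n') * frameKernel ρ ψ J n n' := by
  have hinner : ∀ (j m : ℕ) (k : ℤ),
      ((‖inner ℂ (shift j k (ψ j m)) (∑ n ∈ F, c n • fourierLp 2 n)‖ ^ 2 : ℝ) : ℂ) =
        ∑ n ∈ F, ∑ n' ∈ F, c n * conj (c n') *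
          (conj (fourierCoeff (ψ j m) n) * fourierCoeff (ψ j m) n' *
            fourier (n' - n) (((k : ℝ) / 2 ^ j : ℝ) : UnitAddCircle)) := by
    intro j m k
    rw [Complex.ofReal_pow, ← Complex.mul_conj', inner_sum, map_sum, sum_mul_sum]
    refine sum_congr rfl fun n _ => sum_congr rfl fun n' _ => ?_
    rw [inner_smul_right, inner_smul_right, inner_fourierLp_right, inner_fourierLp_right,
      fourierCoeff_shift, fourierCoeff_shift, sub_eq_add_neg, fourier_add, fourier_neg]
    simp only [map_mul, Complex.conj_conj]
    ring
  unfold partialEnergy frameKernel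
  rw [Complex.ofReal_sum]
  simp only [Complex.ofReal_sum, hinner, mul_sum]
  have hswap : ∀ j m : ℕ, ∑ k ∈ shiftIndex j, ∑ n ∈ F, ∑ n' ∈ F, c n * conj (c n') *
        (conj (fourierCoeff (ψ j m) n) * fourierCoeff (ψ j m) n' *
          fourier (n' - n) (((k : ℝ) / 2 ^ j : ℝ) : UnitAddCircle)) =
      ∑ n ∈ F, ∑ n' ∈ F, c n * conj (c n') * (if (2 : ℤ) ^ j ∣ n' - n then
        2 ^ j * (conj (fourierCoeff (ψ j m) n) * fourierCoeff (ψ j m) n') else 0) := by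
    intro j m
    rw [sum_comm]
    refine sum_congr rfl fun n _ => ?_
    rw [sum_comm]
    refine sum_congr rfl fun n' _ => ?_
    rw [← mul_sum, ← mul_sum, sum_shiftIndex_fourier]
    split_ifs <;> ring
  simp only [hswap]
  have h1 : ∀ j, ∑ m ∈ Icc 1 (ρ j), ∑ n ∈ F, ∑ n' ∈ F, c n * conj (c n') *
      (if (2 : ℤ) ^ j ∣ n' - n then
        2 ^ j * (conj (fourierCoeff (ψ j m) n) * fourierCoeff (ψ j m) n') else 0) =
      ∑ n ∈ F, ∑ n' ∈ F, ∑ m ∈ Icc 1 (ρ j), c n * conj (c n') *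
      (if (2 : ℤ) ^ j ∣ n' - n then
        2 ^ j * (conj (fourierCoeff (ψ j m) n) * fourierCoeff (ψ j m) n') else 0) := by
    intro j
    rw [sum_comm]
    exact sum_congr rfl fun n _ => sum_comm
  simp only [h1]
  rw [sum_comm]
  exact sum_congr rfl fun n _ => sum_comm

theorem norm_sq_trigPoly (F : Finset ℤ) (c : ℤ → ℂ) :
    ((‖(∑ n ∈ F, c n • fourierLp 2 n : L2)‖ ^ 2 : ℝ) : ℂ) = ∑ n ∈ F, c n * conj (c n) := by
  have := (orthonormal_fourier (T := (1 : ℝ))).inner_sum c c F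
  rw [inner_self_eq_norm_sq_to_K] at this
  push_cast
  rw [show ((‖(∑ n ∈ F, c n • fourierLp 2 n : L2)‖ : ℂ) ^ 2) = _ from this]
  exact sum_congr rfl fun n _ => mul_comm _ _

/-- A family of contractions `T_J` that preserves norms in the limit on a dense set does so
everywhere. -/
theorem tendsto_norm_of_dense {H : Type*} [NormedAddCommGroup H] [NormedSpace ℂ H]
    {E : ℕ → Type*} [∀ J, NormedAddCommGroup (E J)] [∀ J, NormedSpace ℂ (E J)]
    (T : ∀ J, H →L[ℂ] E J) {D : Set H} (hD : Dense D)
    (hle : ∀ J, ∀ f ∈ D, ‖T J f‖ ≤ ‖f‖)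
    (hlim : ∀ f ∈ D, Tendsto (fun J => ‖T J f‖) atTop (𝓝 ‖f‖)) (f : H) :
    Tendsto (fun J => ‖T J f‖) atTop (𝓝 ‖f‖) := by
  have hle' : ∀ J, ∀ g : H, ‖T J g‖ ≤ ‖g‖ := by
    intro J g
    have hc : IsClosed {g : H | ‖T J g‖ ≤ ‖g‖} :=
      isClosed_le (T J).continuous.norm continuous_norm
    have : closure D ⊆ {g : H | ‖T J g‖ ≤ ‖g‖} := closure_minimal (hle J) hc
    exact this (hD g)
  rw [Metric.tendsto_atTop]
  intro ε hε
  obtain ⟨p, hp, hfp⟩ := Metric.dense_iff.1 hD f (ε / 3) (by positivity)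
  obtain ⟨N, hN⟩ := Metric.tendsto_atTop.1 (hlim p hfp) (ε / 3) (by positivity)
  refine ⟨N, fun J hJ => ?_⟩
  have h1 := hN J hJ
  rw [Metric.mem_ball, dist_eq_norm] at hp
  rw [Real.dist_eq] at h1 ⊢
  have h2 : |‖T J p‖ - ‖T J f‖| ≤ ‖p - f‖ :=
    (abs_norm_sub_norm_le _ _).trans (by rw [← map_sub]; exact hle' J _)
  have h3 := abs_norm_sub_norm_le p f
  rw [abs_le] at h2 h3
  rw [abs_lt] at h1 ⊢
  constructor <;> linarith [h1.1, h1.2, h2.1, h2.2, h3.1, h3.2]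

/-- The energy of the levels `j < J` is the squared norm of the analysis operator
`f ↦ (⟨S^k_j ψ^m_j, f⟩)`. -/
theorem exists_analysisOperator (ρ : ℕ → ℕ) (ψ : ℕ → ℕ → L2) (J : ℕ) :
    ∃ (ι : Type) (_ : Fintype ι) (T : L2 →L[ℂ] EuclideanSpace ℂ ι),
      ∀ f, ‖T f‖ ^ 2 = partialEnergy ρ ψ J f := by
  let s : Finset (Σ _ : ℕ, Σ _ : ℕ, ℤ) :=
    (range J).sigma fun j => (Icc 1 (ρ j)).sigma fun _ => shiftIndex j
  refine ⟨s, inferInstance, (EuclideanSpace.equiv s ℂ).symm.toContinuousLinearMap.comp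
    (ContinuousLinearMap.pi fun i : s =>
      innerSL ℂ (shift i.1.1 i.1.2.2 (ψ i.1.1 i.1.2.1))), fun f => ?_⟩
  rw [EuclideanSpace.norm_sq_eq]
  have : ∀ i : s, ‖(((EuclideanSpace.equiv s ℂ).symm.toContinuousLinearMap.comp
    (ContinuousLinearMap.pi fun i : s =>
      innerSL ℂ (shift i.1.1 i.1.2.2 (ψ i.1.1 i.1.2.1)))) f).ofLp i‖ ^ 2 =
      (fun i : Σ _ : ℕ, Σ _ : ℕ, ℤ => ‖inner ℂ (shift i.1 i.2.2 (ψ i.1 i.2.1)) f‖ ^ 2) i :=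
    fun i => rfl
  rw [sum_congr rfl fun i _ => this i, sum_coe_sort s
    (fun i : Σ _ : ℕ, Σ _ : ℕ, ℤ => ‖inner ℂ (shift i.1 i.2.2 (ψ i.1 i.2.1)) f‖ ^ 2)]
  simp only [s, sum_sigma]
  rfl

/-- The Parseval identity, entry by entry in the Fourier basis. -/
theorem isParsevalWaveletFrame_iff_kernel (ρ : ℕ → ℕ) (ψ : ℕ → ℕ → L2) :
    IsParsevalWaveletFrame ρ ψ ↔ ∀ n n' : ℤ,
      Tendsto (fun J => frameKernel ρ ψ J n n') atTop (𝓝 (if n = n' then 1 else 0)) := by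
  rw [isParsevalWaveletFrame_iff_tendsto]
  constructor
  · intro h
    have hquad : ∀ (F : Finset ℤ) (c : ℤ → ℂ), Tendsto (fun J => ∑ n ∈ F, ∑ n' ∈ F,
        c n * conj (c n') * frameKernel ρ ψ J n n') atTop (𝓝 (∑ n ∈ F, c n * conj (c n))) := by
      intro F c
      have := (Complex.continuous_ofReal.tendsto _).comp (h (∑ n ∈ F, c n • fourierLp 2 n))
      rw [norm_sq_trigPoly] at this
      refine this.congr fun J => ?_
      exact partialEnergy_trigPoly ρ ψ J F c
    have hdiag : ∀ n, Tendsto (fun J => frameKernel ρ ψ J n n) atTop (𝓝 1) := by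
      intro n
      simpa using hquad {n} fun _ => 1
    intro n n'
    split_ifs with hnn
    · subst hnn
      exact hdiag n
    -- Polarization: test with `e_n + e_{n'}` and with `e_n + i e_{n'}`.
    · have h1 := ((hquad {n, n'} fun _ => 1).sub (hdiag n)).sub (hdiag n')
      have h2 := ((hquad {n, n'} fun x => if x = n then 1 else Complex.I).sub
        (hdiag n)).sub (hdiag n')
      simp only [sum_pair hnn, if_true, if_neg (Ne.symm hnn), map_one, one_mul, mul_one,
        Complex.conj_I, mul_neg, Complex.I_mul_I, neg_neg] at h1 h2
      have h3 := (h1.add (h2.const_mul Complex.I)).div_const 2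
      refine Tendsto.congr (fun J => ?_) (h3.trans (le_of_eq ?_))
      · linear_combination (-(frameKernel ρ ψ J n n') / 2 +
          frameKernel ρ ψ J n' n / 2) * Complex.I_mul_I
      · congr 1
        ring
  · intro h
    have hpoly : ∀ f ∈ (Submodule.span ℂ (Set.range (fourierLp (T := (1 : ℝ)) 2)) : Set L2),
        Tendsto (fun J => partialEnergy ρ ψ J f) atTop (𝓝 (‖f‖ ^ 2)) := by
      intro f hf
      obtain ⟨c, rfl⟩ := Finsupp.mem_span_range_iff_exists_finsupp.1 hf
      change Tendsto (fun J => partialEnergy ρ ψ J (∑ n ∈ c.support, c n • fourierLp 2 n)) atTop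
        (𝓝 (‖(∑ n ∈ c.support, c n • fourierLp 2 n : L2)‖ ^ 2))
      have h1 : Tendsto (fun J => ((partialEnergy ρ ψ J
          (∑ n ∈ c.support, c n • fourierLp 2 n) : ℝ) : ℂ)) atTop
          (𝓝 ((‖(∑ n ∈ c.support, c n • fourierLp 2 n : L2)‖ ^ 2 : ℝ) : ℂ)) := by
        rw [norm_sq_trigPoly]
        simp only [partialEnergy_trigPoly]
        refine tendsto_finsetSum _ fun n hn => ?_
        have h2 := tendsto_finsetSum c.support fun n' (_ : n' ∈ c.support) =>
          (h n n').const_mul (c n * conj (c n'))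
        simp only [mul_ite, mul_one, mul_zero, sum_ite_eq, hn, if_true] at h2
        exact h2
      have h2 := (Complex.continuous_re.tendsto _).comp h1
      simpa only [Function.comp_def, Complex.ofReal_re] using h2
    choose ι hι T hT using exists_analysisOperator ρ ψ
    have hnorm : ∀ J f, ‖T J f‖ = √(partialEnergy ρ ψ J f) := fun J f => by
      rw [← hT, Real.sqrt_sq (norm_nonneg _)]
    have hD : Dense (Submodule.span ℂ (Set.range (fourierLp (T := (1 : ℝ)) 2)) : Set L2) := by
      rw [← Submodule.dense_iff_topologicalClosure_eq_top.symm]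
      exact span_fourierLp_closure_eq_top (by norm_num)
    intro f
    have h1 := tendsto_norm_of_dense T hD (fun J g hg => ?_) (fun g hg => ?_) f
    · have h2 := h1.pow 2
      simpa only [hT] using h2
    · rw [hnorm, ← Real.sqrt_sq (norm_nonneg g)]
      exact Real.sqrt_le_sqrt
        ((partialEnergy_monotone ρ ψ g).ge_of_tendsto (hpoly g hg) J)
    · have h3 := (hpoly g hg).sqrt
      rw [Real.sqrt_sq (norm_nonneg g)] at h3
      simpa only [hnorm] using h3

/-! ### The frame kernel in terms of the masks -/

/-- The refinement equations together with the periodicity of the masks. -/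
structure RefinementSystem (ρ : ℕ → ℕ) (φ : ℕ → L2) (ψ : ℕ → ℕ → L2)
    (a : ℕ → ℤ → ℂ) (b : ℕ → ℕ → ℤ → ℂ) : Prop where
  periodic_a : ∀ j : ℕ, 1 ≤ j → Function.Periodic (a (j + 1)) ((2 : ℤ) ^ (j + 1))
  periodic_b : ∀ j : ℕ, ∀ m ∈ Icc 1 (ρ j), Function.Periodic (b (j + 1) m) ((2 : ℤ) ^ (j + 1))
  refine_φ : ∀ j : ℕ, 1 ≤ j → ∀ n : ℤ,
    fourierCoeff (φ j) n = (√2 : ℝ) * a (j + 1) n * fourierCoeff (φ (j + 1)) n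
  refine_ψ : ∀ j : ℕ, ∀ m ∈ Icc 1 (ρ j), ∀ n : ℤ,
    fourierCoeff (ψ j m) n = (√2 : ℝ) * b (j + 1) m n * fourierCoeff (φ (j + 1)) n

/-- The Hermitian product of the mask vectors `(√θ_j a_{j+1}, b^1_{j+1}, …)` at `n` and `n'`,
where `n' ≡ n` modulo `2^j`, so that `θ_j(n') = θ_j(n)`. -/
noncomputable def maskProduct (ρ : ℕ → ℕ) (a : ℕ → ℤ → ℂ) (b : ℕ → ℕ → ℤ → ℂ) (j : ℕ)
    (n n' : ℤ) : ℂ :=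
  ∑ m ∈ Icc 1 (ρ j), conj (b (j + 1) m n) * b (j + 1) m n' +
    theta ρ a b j n * (conj (a (j + 1) n) * a (j + 1) n')

theorem eq_of_dvd_of_periodic {α : Type*} {f : ℤ → α} {N : ℤ} (hf : Function.Periodic f N)
    {n n' : ℤ} (h : N ∣ n' - n) : f n' = f n := by
  obtain ⟨k, hk⟩ := h
  have := hf.int_mul k n
  rw [← this]
  congr 1
  push_cast
  linarith

theorem sqrt_two_mul_sqrt_two : ((√2 : ℝ) : ℂ) * ((√2 : ℝ) : ℂ) = 2 := by
  rw [← Complex.ofReal_mul, Real.mul_self_sqrt (by norm_num)]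
  norm_num

theorem maskEnergy_nonneg (ρ : ℕ → ℕ) (b : ℕ → ℕ → ℤ → ℂ) (j : ℕ) (n : ℤ) :
    0 ≤ maskEnergy ρ b j n := by
  unfold maskEnergy; positivity

theorem theta_nonneg (ρ : ℕ → ℕ) (a : ℕ → ℤ → ℂ) (b : ℕ → ℕ → ℤ → ℂ) (j : ℕ) (n : ℤ) :
    0 ≤ theta ρ a b j n := by
  induction j with
  | zero => exact le_rfl
  | succ j ih =>
    have := maskEnergy_nonneg ρ b (j + 1) n
    unfold theta; positivity

theorem maskProduct_self (ρ : ℕ → ℕ) (a : ℕ → ℤ → ℂ) (b : ℕ → ℕ → ℤ → ℂ) (j : ℕ) (n : ℤ) :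
    maskProduct ρ a b j n n = theta ρ a b (j + 1) n := by
  simp [maskProduct, theta, maskEnergy, Complex.conj_mul']

theorem theta_eq_zero_iff {ρ : ℕ → ℕ} {a : ℕ → ℤ → ℂ} {b : ℕ → ℕ → ℤ → ℂ} {j : ℕ} {n : ℤ} :
    theta ρ a b (j + 1) n = 0 ↔
      maskEnergy ρ b (j + 1) n = 0 ∧ theta ρ a b j n * ‖a (j + 1) n‖ ^ 2 = 0 := by
  have h1 := maskEnergy_nonneg ρ b (j + 1) n
  have h2 := theta_nonneg ρ a b j n
  rw [theta]
  exact add_eq_zero_iff_of_nonneg h1 (by positivity)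

theorem maskEnergy_eq_zero_iff {ρ : ℕ → ℕ} {b : ℕ → ℕ → ℤ → ℂ} {j : ℕ} {n : ℤ} :
    maskEnergy ρ b j n = 0 ↔ ∀ m ∈ Icc 1 (ρ (j - 1)), b j m n = 0 := by
  unfold maskEnergy
  rw [sum_eq_zero_iff_of_nonneg fun _ _ => by positivity]
  simp

namespace RefinementSystem

variable {ρ : ℕ → ℕ} {φ : ℕ → L2} {ψ : ℕ → ℕ → L2} {a : ℕ → ℤ → ℂ} {b : ℕ → ℕ → ℤ → ℂ}

theorem b_congr (S : RefinementSystem ρ φ ψ a b) {j m : ℕ} (hm : m ∈ Icc 1 (ρ j)) {n n' : ℤ}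
    (h : (2 : ℤ) ^ (j + 1) ∣ n' - n) : b (j + 1) m n' = b (j + 1) m n :=
  eq_of_dvd_of_periodic (S.periodic_b j m hm) h

theorem a_congr (S : RefinementSystem ρ φ ψ a b) {j : ℕ} (hj : 1 ≤ j) {n n' : ℤ}
    (h : (2 : ℤ) ^ (j + 1) ∣ n' - n) : a (j + 1) n' = a (j + 1) n :=
  eq_of_dvd_of_periodic (S.periodic_a j hj) h

theorem maskEnergy_congr (S : RefinementSystem ρ φ ψ a b) {j : ℕ} {n n' : ℤ}
    (h : (2 : ℤ) ^ (j + 1) ∣ n' - n) :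
    maskEnergy ρ b (j + 1) n' = maskEnergy ρ b (j + 1) n :=
  sum_congr rfl fun m hm => by rw [S.b_congr (j := j) hm h]

/-- No periodicity of `a 1` is needed, as it only occurs multiplied by `θ_0 = 0`. -/
theorem theta_congr (S : RefinementSystem ρ φ ψ a b) {j : ℕ} {n n' : ℤ}
    (h : (2 : ℤ) ^ j ∣ n' - n) : theta ρ a b j n' = theta ρ a b j n := by
  induction j with
  | zero => rfl
  | succ j ih =>
    rw [theta, theta, S.maskEnergy_congr h, ih ((pow_dvd_pow 2 (by omega)).trans h)]
    rcases j with _ | j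
    · simp [theta]
    · rw [S.a_congr (by omega) h]

theorem maskProduct_congr (S : RefinementSystem ρ φ ψ a b) {j : ℕ} {n n' l l' : ℤ}
    (h : (2 : ℤ) ^ (j + 1) ∣ n' - n) (h' : (2 : ℤ) ^ (j + 1) ∣ l' - l) :
    maskProduct ρ a b j n' l' = maskProduct ρ a b j n l := by
  unfold maskProduct
  rw [S.theta_congr ((pow_dvd_pow 2 (by omega)).trans h)]
  congr 1
  · exact sum_congr rfl fun m hm => by rw [S.b_congr hm h, S.b_congr hm h']
  · rcases j with _ | j
    · simp [theta]
    · rw [S.a_congr (by omega) h, S.a_congr (by omega) h']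

theorem conj_maskProduct (S : RefinementSystem ρ φ ψ a b) {j : ℕ} {n n' : ℤ}
    (h : (2 : ℤ) ^ j ∣ n' - n) :
    conj (maskProduct ρ a b j n n') = maskProduct ρ a b j n' n := by
  simp only [maskProduct, map_add, map_sum, map_mul, Complex.conj_conj, Complex.conj_ofReal,
    S.theta_congr h]
  congr 1
  · exact sum_congr rfl fun m _ => mul_comm _ _
  · ring

theorem maskProduct_eq_theta (S : RefinementSystem ρ φ ψ a b) {j : ℕ} {n n' : ℤ}
    (h : (2 : ℤ) ^ (j + 1) ∣ n' - n) :
    maskProduct ρ a b j n n' = theta ρ a b (j + 1) n := by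
  rw [← maskProduct_self, S.maskProduct_congr (n := n) (l := n) (by simp) h]

theorem theta_mul_fourierCoeff (S : RefinementSystem ρ φ ψ a b) (j : ℕ) (l n : ℤ) :
    (theta ρ a b j l : ℂ) * fourierCoeff (φ j) n =
      theta ρ a b j l * ((√2 : ℝ) * a (j + 1) n * fourierCoeff (φ (j + 1)) n) := by
  rcases j with _ | j
  · simp [theta]
  · rw [S.refine_φ (j + 1) (by omega)]

/-- One step of the telescoping that evaluates the frame kernel. -/
theorem kernel_step (S : RefinementSystem ρ φ ψ a b) (j : ℕ) (n n' : ℤ) :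
    2 ^ j * theta ρ a b j n * (conj (fourierCoeff (φ j) n) * fourierCoeff (φ j) n') +
      ∑ m ∈ Icc 1 (ρ j), 2 ^ j * (conj (fourierCoeff (ψ j m) n) * fourierCoeff (ψ j m) n') =
      2 ^ (j + 1) * maskProduct ρ a b j n n' *
        (conj (fourierCoeff (φ (j + 1)) n) * fourierCoeff (φ (j + 1)) n') := by
  have h1 : ∀ m ∈ Icc 1 (ρ j), 2 ^ j * (conj (fourierCoeff (ψ j m) n) * fourierCoeff (ψ j m) n') =
      (conj (b (j + 1) m n) * b (j + 1) m n') * (2 ^ (j + 1) *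
        (conj (fourierCoeff (φ (j + 1)) n) * fourierCoeff (φ (j + 1)) n')) := by
    intro m hm
    rw [S.refine_ψ j m hm, S.refine_ψ j m hm]
    simp only [map_mul, Complex.conj_ofReal]
    linear_combination (2 ^ j * conj (b (j + 1) m n) * b (j + 1) m n' *
      (conj (fourierCoeff (φ (j + 1)) n) * fourierCoeff (φ (j + 1)) n')) * sqrt_two_mul_sqrt_two
  have h2 := S.theta_mul_fourierCoeff j n n'
  have h3 := congrArg conj (S.theta_mul_fourierCoeff j n n)
  simp only [map_mul, Complex.conj_ofReal] at h3
  rw [sum_congr rfl h1, ← sum_mul, maskProduct]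
  linear_combination 2 ^ j * conj (fourierCoeff (φ j) n) * h2 +
    2 ^ j * (√2 : ℝ) * a (j + 1) n' * fourierCoeff (φ (j + 1)) n' * h3 +
    2 ^ j * theta ρ a b j n * conj (a (j + 1) n) * a (j + 1) n' *
      (conj (fourierCoeff (φ (j + 1)) n) * fourierCoeff (φ (j + 1)) n') * sqrt_two_mul_sqrt_two

theorem frameKernel_of_dvd (S : RefinementSystem ρ φ ψ a b) {J : ℕ} {n n' : ℤ}
    (h : (2 : ℤ) ^ J ∣ n' - n) :
    frameKernel ρ ψ J n n' =
      2 ^ J * theta ρ a b J n * (conj (fourierCoeff (φ J) n) * fourierCoeff (φ J) n') := by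
  induction J with
  | zero => simp [frameKernel, theta]
  | succ J ih =>
    have h' : (2 : ℤ) ^ J ∣ n' - n := (pow_dvd_pow 2 (by omega)).trans h
    rw [frameKernel, sum_range_succ, ← frameKernel, ih h']
    simp only [h', if_true]
    rw [S.kernel_step, S.maskProduct_eq_theta h]

theorem frameKernel_self (S : RefinementSystem ρ φ ψ a b) (J : ℕ) (n : ℤ) :
    frameKernel ρ ψ J n n =
      ((2 ^ J * theta ρ a b J n * ‖fourierCoeff (φ J) n‖ ^ 2 : ℝ) : ℂ) := by
  rw [S.frameKernel_of_dvd (by simp), Complex.conj_mul']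
  push_cast
  rfl

/-- Off the diagonal the kernel is eventually constant. -/
theorem frameKernel_of_not_dvd (S : RefinementSystem ρ φ ψ a b) {L J : ℕ} {n n' : ℤ}
    (h : (2 : ℤ) ^ L ∣ n' - n) (h' : ¬ (2 : ℤ) ^ (L + 1) ∣ n' - n) (hJ : L + 1 ≤ J) :
    frameKernel ρ ψ J n n' = 2 ^ (L + 1) * maskProduct ρ a b L n n' *
      (conj (fourierCoeff (φ (L + 1)) n) * fourierCoeff (φ (L + 1)) n') := by
  induction J, hJ using Nat.le_induction with
  | base =>
    rw [frameKernel, sum_range_succ, ← frameKernel, S.frameKernel_of_dvd h]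
    simp only [h, if_true]
    exact S.kernel_step L n n'
  | succ J hJ ih =>
    rw [frameKernel, sum_range_succ, ← frameKernel, ih]
    have : ¬ (2 : ℤ) ^ J ∣ n' - n := fun h2 => h' ((pow_dvd_pow 2 hJ).trans h2)
    simp [this]

/-- The fundamental characterisation: the system is a Parseval frame iff the mask vectors at `n`
and `n + 2^j` are orthogonal wherever the scaling functions can see both of them, and
`2^J θ_J |φ̂_J|²` tends to `1`. -/
theorem isParsevalWaveletFrame_iff (S : RefinementSystem ρ φ ψ a b) :
    IsParsevalWaveletFrame ρ ψ ↔
      (∀ (j : ℕ) (n k : ℤ), Odd k → fourierCoeff (φ (j + 1)) n ≠ 0 →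
        fourierCoeff (φ (j + 1)) (n + 2 ^ j * k) ≠ 0 →
          maskProduct ρ a b j n (n + 2 ^ j * k) = 0) ∧
      ∀ n : ℤ, Tendsto (fun J => 2 ^ J * theta ρ a b J n * ‖fourierCoeff (φ J) n‖ ^ 2) atTop
        (𝓝 1) := by
  rw [isParsevalWaveletFrame_iff_kernel]
  have hodd : ∀ (L : ℕ) (n k : ℤ), Odd k → ¬ (2 : ℤ) ^ (L + 1) ∣ n + 2 ^ L * k - n := by
    intro L n k hk hd
    rw [add_sub_cancel_left, pow_succ] at hd
    have := (mul_dvd_mul_iff_left (a := (2 : ℤ) ^ L) (by positivity)).1 hd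
    exact (Int.not_even_iff_odd.2 hk) (even_iff_two_dvd.2 this)
  constructor
  · intro h
    refine ⟨fun j n k hk h1 h2 => ?_, fun n => ?_⟩
    · have hd := hodd j n k hk
      have hne : n ≠ n + 2 ^ j * k := by
        intro h3
        rw [← h3] at hd
        simp at hd
      have h3 := h n (n + 2 ^ j * k)
      rw [if_neg hne] at h3
      have h4 : Tendsto (fun J => frameKernel ρ ψ J n (n + 2 ^ j * k)) atTop (𝓝 _) :=
        tendsto_const_nhds.congr' (by
          filter_upwards [eventually_ge_atTop (j + 1)] with J hJ
          exact (S.frameKernel_of_not_dvd (by simp) hd hJ).symm)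
      have h5 := tendsto_nhds_unique h4 h3
      have h6 : conj (fourierCoeff (φ (j + 1)) n) ≠ 0 := by simpa using h1
      simpa [h1, h2, h6] using h5
    · have h1 := h n n
      simp only [S.frameKernel_self, if_true] at h1
      simpa only [Function.comp_def, Complex.ofReal_re, Complex.one_re] using
        (Complex.continuous_re.tendsto _).comp h1
  · rintro ⟨hA, hB⟩ n n'
    split_ifs with hn
    · subst hn
      simp only [S.frameKernel_self]
      exact (Complex.continuous_ofReal.tendsto _).comp (hB n)
    · obtain ⟨L, k, hk, hko⟩ : ∃ (L : ℕ) (k : ℤ), n' = n + 2 ^ L * k ∧ Odd k := by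
        have hfin : FiniteMultiplicity (2 : ℤ) (n' - n) :=
          Int.finiteMultiplicity_iff.2 ⟨by norm_num, sub_ne_zero.2 (Ne.symm hn)⟩
        obtain ⟨k, hk, hk'⟩ := hfin.exists_eq_pow_mul_and_not_dvd
        exact ⟨_, k, by rw [← hk]; ring,
          Int.not_even_iff_odd.1 fun he => hk' (even_iff_two_dvd.1 he)⟩
      subst hk
      refine tendsto_const_nhds.congr' ?_
      filter_upwards [eventually_ge_atTop (L + 1)] with J hJ
      rw [S.frameKernel_of_not_dvd (by simp) (hodd L n k hko) hJ]
      by_cases h1 : fourierCoeff (φ (L + 1)) n = 0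
      · simp [h1]
      by_cases h2 : fourierCoeff (φ (L + 1)) (n + 2 ^ L * k) = 0
      · simp [h2]
      simp [hA L n k hko h1 h2]

end RefinementSystem

/-! ### Spherical coordinates on the complex unit sphere -/

/-- The point of the unit sphere of `ℂ^{N+1}` with spherical coordinates `s_1, …, s_N` and phases
`s_{N+1}, …, s_{2N+1}`. -/
noncomputable def sphericalVector (N : ℕ) (s : ℕ → ℝ) (m : ℕ) : ℂ :=
  (sphericalFactor N s m : ℂ) * Complex.exp (Complex.I * (s (N + 1 + m) : ℂ))

theorem aTilde_eq_sphericalVector (ρ : ℕ → ℕ) (t : ℕ → ℤ → ℕ → ℝ) (j : ℕ) (n : ℤ) :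
    aTilde ρ t (j + 1) n = sphericalVector (ρ j) (t (j + 1) n) 0 := rfl

theorem bTilde_eq_sphericalVector (ρ : ℕ → ℕ) (t : ℕ → ℤ → ℕ → ℝ) (j m : ℕ) (n : ℤ) :
    bTilde ρ t (j + 1) m n = sphericalVector (ρ j) (t (j + 1) n) m := rfl

theorem sum_Icc_zero {M : Type*} [AddCommMonoid M] (N : ℕ) (f : ℕ → M) :
    ∑ m ∈ Icc 0 N, f m = f 0 + ∑ m ∈ Icc 1 N, f m := by
  rw [show Icc 0 N = insert 0 (Icc 1 N) by ext; simp; omega, sum_insert (by simp)]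

theorem sphericalFactor_succ {N m : ℕ} (hm : m ≤ N) (s : ℕ → ℝ) :
    sphericalFactor (N + 1) s m = sphericalFactor N s m * Real.cos (s (N + 1)) := by
  rw [sphericalFactor, sphericalFactor, prod_Icc_succ_top (by omega), mul_assoc]

theorem sphericalFactor_top (N : ℕ) (s : ℕ → ℝ) :
    sphericalFactor (N + 1) s (N + 1) = Real.sin (s (N + 1)) := by
  simp [sphericalFactor]

theorem sphericalFactor_congr {N m : ℕ} {s s' : ℕ → ℝ} (hm : m ≤ N)
    (h : ∀ r, r ≤ N → s r = s' r) : sphericalFactor N s m = sphericalFactor N s' m := by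
  unfold sphericalFactor
  rw [h m hm]
  congr 1
  exact prod_congr rfl fun r hr => by rw [h r (mem_Icc.1 hr).2]

theorem sum_sphericalFactor_sq (N : ℕ) (s : ℕ → ℝ) :
    ∑ m ∈ Icc 0 N, sphericalFactor N s m ^ 2 = 1 := by
  induction N with
  | zero => simp [sphericalFactor]
  | succ N ih =>
    rw [sum_Icc_succ_top (by omega), sphericalFactor_top,
      sum_congr rfl fun m hm => by rw [sphericalFactor_succ (mem_Icc.1 hm).2, mul_pow],
      ← sum_mul, ih, one_mul, Real.cos_sq_add_sin_sq]

theorem exists_sphericalFactor_eq (N : ℕ) (x : ℕ → ℝ) (hx : ∀ m, 0 ≤ x m)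
    (h1 : ∑ m ∈ Icc 0 N, x m ^ 2 = 1) :
    ∃ s : ℕ → ℝ, ∀ m ≤ N, sphericalFactor N s m = x m := by
  induction N generalizing x with
  | zero =>
    refine ⟨0, fun m hm => ?_⟩
    obtain rfl : m = 0 := by omega
    have h2 : x 0 ^ 2 = 1 := by simpa using h1
    have h3 : x 0 = 1 := by nlinarith [hx 0]
    simp [sphericalFactor, h3]
  | succ N ih =>
    rw [sum_Icc_succ_top (by omega)] at h1
    set y := x (N + 1) with hy
    have hy0 : 0 ≤ y := hx _
    have hsum : 0 ≤ ∑ m ∈ Icc 0 N, x m ^ 2 := by positivity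
    have hy1 : y ≤ 1 := by nlinarith
    set R := √(1 - y ^ 2) with hR
    have hR2 : R ^ 2 = 1 - y ^ 2 := Real.sq_sqrt (by nlinarith)
    obtain ⟨s, hs⟩ : ∃ s : ℕ → ℝ, ∀ m ≤ N, sphericalFactor N s m * R = x m := by
      by_cases hR0 : R = 0
      · refine ⟨0, fun m hm => ?_⟩
        have h2 : ∑ m ∈ Icc 0 N, x m ^ 2 = 0 := by rw [hR0] at hR2; linarith
        have h3 := (sum_eq_zero_iff_of_nonneg fun _ _ => sq_nonneg _).1 h2 m (by simp [hm])
        rw [hR0, mul_zero, pow_eq_zero_iff (by norm_num) |>.1 h3]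
      · obtain ⟨s, hs⟩ := ih (fun m => x m / R)
          (fun m => div_nonneg (hx m) (Real.sqrt_nonneg _)) (by
            simp only [div_pow, ← sum_div]
            rw [div_eq_one_iff_eq (by positivity)]
            linarith)
        exact ⟨s, fun m hm => by rw [hs m hm, div_mul_cancel₀ _ hR0]⟩
    refine ⟨Function.update s (N + 1) (Real.arcsin y), fun m hm => ?_⟩
    rcases Nat.lt_or_ge N m with h | h
    · obtain rfl : m = N + 1 := by omega
      rw [sphericalFactor_top, Function.update_self, Real.sin_arcsin (by linarith) hy1]
    · rw [sphericalFactor_succ h, Function.update_self, Real.cos_arcsin, ← hs m h,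
        sphericalFactor_congr h fun r hr => Function.update_of_ne (by omega) _ _]

theorem norm_sphericalVector (N : ℕ) (s : ℕ → ℝ) (m : ℕ) :
    ‖sphericalVector N s m‖ = |sphericalFactor N s m| := by
  rw [sphericalVector, norm_mul, Complex.norm_real, Real.norm_eq_abs, mul_comm Complex.I,
    Complex.norm_exp_ofReal_mul_I, mul_one]

theorem sum_norm_sq_sphericalVector (N : ℕ) (s : ℕ → ℝ) :
    ∑ m ∈ Icc 0 N, ‖sphericalVector N s m‖ ^ 2 = 1 := by
  simp only [norm_sphericalVector, sq_abs, sum_sphericalFactor_sq]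

/-- Every unit vector has spherical coordinates. -/
theorem exists_sphericalVector_eq (N : ℕ) (v : ℕ → ℂ) (hv : ∑ m ∈ Icc 0 N, ‖v m‖ ^ 2 = 1) :
    ∃ s : ℕ → ℝ, ∀ m ≤ N, sphericalVector N s m = v m := by
  obtain ⟨s, hs⟩ := exists_sphericalFactor_eq N (fun m => ‖v m‖) (fun m => norm_nonneg _) hv
  refine ⟨fun r => if r ≤ N then s r else (v (r - (N + 1))).arg, fun m hm => ?_⟩
  rw [sphericalVector, sphericalFactor_congr (s' := s) hm fun r hr => if_pos hr, hs m hm,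
    if_neg (by omega), Nat.add_sub_cancel_left, mul_comm Complex.I, Complex.norm_mul_exp_arg_mul_I]

/-- The two real linking equations say that the two unit vectors are orthogonal. -/
theorem linkingSystem_iff (N : ℕ) (s₀ s₁ : ℕ → ℝ) :
    LinkingSystem N s₀ s₁ ↔
      ∑ m ∈ Icc 0 N, conj (sphericalVector N s₀ m) * sphericalVector N s₁ m = 0 := by
  have hterm : ∀ m, conj (sphericalVector N s₀ m) * sphericalVector N s₁ m =
      ((Real.cos (s₀ (N + 1 + m) - s₁ (N + 1 + m)) *
        (sphericalFactor N s₀ m * sphericalFactor N s₁ m) : ℝ) : ℂ) -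
      ((Real.sin (s₀ (N + 1 + m) - s₁ (N + 1 + m)) *
        (sphericalFactor N s₀ m * sphericalFactor N s₁ m) : ℝ) : ℂ) * Complex.I := by
    intro m
    have h1 : Complex.exp (-(Complex.I * (s₀ (N + 1 + m) : ℂ))) *
        Complex.exp (Complex.I * (s₁ (N + 1 + m) : ℂ)) =
        Complex.cos (s₀ (N + 1 + m) - s₁ (N + 1 + m)) -
          Complex.sin (s₀ (N + 1 + m) - s₁ (N + 1 + m)) * Complex.I := by
      rw [← Complex.exp_add, show -(Complex.I * (s₀ (N + 1 + m) : ℂ)) +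
        Complex.I * (s₁ (N + 1 + m) : ℂ) =
        (-((s₀ (N + 1 + m) : ℂ) - s₁ (N + 1 + m))) * Complex.I by ring, Complex.exp_mul_I,
        Complex.cos_neg, Complex.sin_neg]
      ring
    simp only [sphericalVector, map_mul, Complex.conj_ofReal, ← Complex.exp_conj, Complex.conj_I,
      neg_mul]
    push_cast
    linear_combination (sphericalFactor N s₀ m : ℂ) * sphericalFactor N s₁ m * h1
  simp only [hterm, sum_sub_distrib, ← sum_mul, ← Complex.ofReal_sum]
  have hzero : ∀ x y : ℝ, (x : ℂ) - (y : ℂ) * Complex.I = 0 ↔ x = 0 ∧ y = 0 := fun x y => by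
    simp [Complex.ext_iff]
  rw [hzero, LinkingSystem]

theorem LinkingSystem.symm {N : ℕ} {s₀ s₁ : ℕ → ℝ} (h : LinkingSystem N s₀ s₁) :
    LinkingSystem N s₁ s₀ := by
  rw [linkingSystem_iff] at h ⊢
  have := congrArg conj h
  simpa [mul_comm] using this

theorem exists_unit_orthogonal {N : ℕ} (hN : 0 < N) (u : ℕ → ℂ) :
    ∃ w : ℕ → ℂ, ∑ m ∈ Icc 0 N, ‖w m‖ ^ 2 = 1 ∧ ∑ m ∈ Icc 0 N, conj (u m) * w m = 0 := by
  have hsplit : ∀ {M : Type} [AddCommMonoid M] (f : ℕ → M), (∀ m, 2 ≤ m → f m = 0) →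
      ∑ m ∈ Icc 0 N, f m = f 0 + f 1 := by
    intro M _ f hf
    rw [← sum_pair (zero_ne_one' ℕ)]
    refine (sum_subset (fun m hm => ?_) fun m _ hm => hf m ?_).symm
    · simp only [mem_insert, mem_singleton] at hm
      simp only [mem_Icc]; omega
    · simp only [mem_insert, mem_singleton, not_or] at hm
      omega
  obtain ⟨p, q, hpq, horth⟩ : ∃ p q : ℂ, ‖p‖ ^ 2 + ‖q‖ ^ 2 = 1 ∧
      conj (u 0) * p + conj (u 1) * q = 0 := by
    by_cases h : ‖u 0‖ ^ 2 + ‖u 1‖ ^ 2 = 0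
    · have h0 : u 0 = 0 := norm_eq_zero.1 (by nlinarith [sq_nonneg ‖u 0‖, sq_nonneg ‖u 1‖])
      exact ⟨1, 0, by simp, by simp [h0]⟩
    · have hpos : 0 < ‖u 0‖ ^ 2 + ‖u 1‖ ^ 2 := lt_of_le_of_ne (by positivity) (Ne.symm h)
      refine ⟨-conj (u 1) / √(‖u 0‖ ^ 2 + ‖u 1‖ ^ 2), conj (u 0) / √(‖u 0‖ ^ 2 + ‖u 1‖ ^ 2),
        ?_, by ring⟩
      simp only [norm_div, norm_neg, RCLike.norm_conj, Complex.norm_real, Real.norm_eq_abs,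
        div_pow, sq_abs, Real.sq_sqrt hpos.le]
      field_simp
      ring
  refine ⟨fun m => if m = 0 then p else if m = 1 then q else 0, ?_, ?_⟩
  · rw [hsplit _ fun m hm => by simp [show m ≠ 0 by omega, show m ≠ 1 by omega]]
    simpa using hpq
  · rw [hsplit _ fun m hm => by simp [show m ≠ 0 by omega, show m ≠ 1 by omega]]
    simpa using horth

/-- Linked parameters exist even if neither, or only one, of the two unit vectors is prescribed:
an unprescribed vector can be chosen orthogonal, since the dimension `N + 1` is at least `2`. -/
theorem exists_linked {N : ℕ} (hN : 0 < N) (p q : Prop) (u v : ℕ → ℂ)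
    (hu : p → ∑ m ∈ Icc 0 N, ‖u m‖ ^ 2 = 1) (hv : q → ∑ m ∈ Icc 0 N, ‖v m‖ ^ 2 = 1)
    (huv : p → q → ∑ m ∈ Icc 0 N, conj (u m) * v m = 0) :
    ∃ s₀ s₁ : ℕ → ℝ, (p → ∀ m ≤ N, sphericalVector N s₀ m = u m) ∧
      (q → ∀ m ≤ N, sphericalVector N s₁ m = v m) ∧ LinkingSystem N s₀ s₁ := by
  have key : ∀ u v : ℕ → ℂ, ∑ m ∈ Icc 0 N, ‖u m‖ ^ 2 = 1 → ∑ m ∈ Icc 0 N, ‖v m‖ ^ 2 = 1 →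
      ∑ m ∈ Icc 0 N, conj (u m) * v m = 0 →
      ∃ s₀ s₁ : ℕ → ℝ, (∀ m ≤ N, sphericalVector N s₀ m = u m) ∧
      (∀ m ≤ N, sphericalVector N s₁ m = v m) ∧ LinkingSystem N s₀ s₁ := by
    intro u v hu hv huv
    obtain ⟨s₀, h₀⟩ := exists_sphericalVector_eq N u hu
    obtain ⟨s₁, h₁⟩ := exists_sphericalVector_eq N v hv
    refine ⟨s₀, s₁, h₀, h₁, (linkingSystem_iff _ _ _).2 ?_⟩
    rw [← huv]
    exact sum_congr rfl fun m hm => by rw [h₀ m (mem_Icc.1 hm).2, h₁ m (mem_Icc.1 hm).2]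
  have hprescribe : ∀ u : ℕ → ℂ, ∑ m ∈ Icc 0 N, ‖u m‖ ^ 2 = 1 →
      ∃ s₀ s₁ : ℕ → ℝ, (∀ m ≤ N, sphericalVector N s₀ m = u m) ∧ LinkingSystem N s₀ s₁ := by
    intro u hu
    obtain ⟨w, hw, huw⟩ := exists_unit_orthogonal hN u
    obtain ⟨s₀, s₁, h₀, -, h⟩ := key u w hu hw huw
    exact ⟨s₀, s₁, h₀, h⟩
  by_cases hp : p <;> by_cases hq : q
  · obtain ⟨s₀, s₁, h₀, h₁, h⟩ := key u v (hu hp) (hv hq) (huv hp hq)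
    exact ⟨s₀, s₁, fun _ => h₀, fun _ => h₁, h⟩
  · obtain ⟨s₀, s₁, h₀, h⟩ := hprescribe u (hu hp)
    exact ⟨s₀, s₁, fun _ => h₀, fun h => absurd h hq, h⟩
  · obtain ⟨s₁, s₀, h₁, h⟩ := hprescribe v (hv hq)
    exact ⟨s₀, s₁, fun h => absurd h hp, fun _ => h₁, h.symm⟩
  · obtain ⟨s₀, s₁, -, h⟩ := hprescribe _ (sum_norm_sq_sphericalVector N 0)
    exact ⟨s₀, s₁, fun h => absurd h hp, fun h => absurd h hq, h⟩

/-- Choosing values pairwise at `n` and `n + q`, for one representative of each pair of classes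
modulo `2q`. -/
theorem exists_periodic_pairing {α : Type*} {q : ℤ} (hq : 0 < q) (P : ℤ → α → Prop)
    (R : α → α → Prop) (hR : ∀ x y, R x y → R y x)
    (hP : ∀ n n' x, 2 * q ∣ n' - n → P n x → P n' x)
    (h : ∀ n, ∃ x y, P n x ∧ P (n + q) y ∧ R x y) :
    ∃ t : ℤ → α, Function.Periodic t (2 * q) ∧ (∀ n, P n (t n)) ∧ ∀ n, R (t n) (t (n + q)) := by
  choose x y hx hy hxy using h
  have hmod : ∀ n, 2 * q ∣ n - n % (2 * q) := fun n => Int.dvd_self_sub_emod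
  have hadd : ∀ n, (n % (2 * q) < q → (n + q) % (2 * q) = n % (2 * q) + q) ∧
      (q ≤ n % (2 * q) → (n + q) % (2 * q) = n % (2 * q) - q) := by
    intro n
    have h0 := Int.emod_nonneg n (show 2 * q ≠ 0 by omega)
    have h1 := Int.emod_lt_of_pos n (show 0 < 2 * q by omega)
    constructor
    · intro h
      rw [← Int.emod_add_emod, Int.emod_eq_of_lt (by omega) (by omega)]
    · intro h
      rw [← Int.emod_add_emod, ← Int.sub_emod_right, Int.emod_eq_of_lt (by omega) (by omega)]
      ring
  refine ⟨fun n => if n % (2 * q) < q then x (n % (2 * q)) else y (n % (2 * q) - q),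
    fun n => ?_, fun n => ?_, fun n => ?_⟩
  · simp only [Int.add_emod_right]
  · simp only
    split_ifs with h
    · exact hP _ _ _ (hmod n) (hx _)
    · have := hy (n % (2 * q) - q)
      rw [sub_add_cancel] at this
      exact hP _ _ _ (hmod n) this
  · simp only
    by_cases h : n % (2 * q) < q
    · have h0 := Int.emod_nonneg n (show 2 * q ≠ 0 by omega)
      rw [if_pos h, (hadd n).1 h, if_neg (by omega), add_sub_cancel_right]
      exact hxy _
    · have h1 := Int.emod_lt_of_pos n (show 0 < 2 * q by omega)
      rw [if_neg h, (hadd n).2 (by omega), if_pos (by omega)]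
      exact hR _ _ (hxy _)

/-! ### The levels `j_0(n)` and `j_1(n)` -/

/-- The mask vector `(√θ_j(n) a_{j+1}(n), b^1_{j+1}(n), …, b^{ρ_j}_{j+1}(n))`, of squared norm
`θ_{j+1}(n)`, divided by its norm. It is the zero vector if `θ_{j+1}(n) = 0`. -/
noncomputable def unitMask (ρ : ℕ → ℕ) (a : ℕ → ℤ → ℂ) (b : ℕ → ℕ → ℤ → ℂ) (j : ℕ) (n : ℤ)
    (m : ℕ) : ℂ :=
  (if m = 0 then √(theta ρ a b j n) * a (j + 1) n else b (j + 1) m n) /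
    √(theta ρ a b (j + 1) n)

/-- The parameters `t` are spherical coordinates of the normalised mask vectors at `n`, at all
levels above `j_1(n)`. -/
def RepresentsMasks (ρ : ℕ → ℕ) (φ : ℕ → L2) (a : ℕ → ℤ → ℂ) (b : ℕ → ℕ → ℤ → ℂ)
    (t : ℕ → ℤ → ℕ → ℝ) (n : ℤ) : Prop :=
  ∀ j, level1 ρ φ b n ≤ j → ∀ m ≤ ρ j, sphericalVector (ρ j) (t (j + 1) n) m = unitMask ρ a b j n m

theorem maskEnergy_eq_zero_of_lt_level1 {ρ : ℕ → ℕ} {φ : ℕ → L2} {b : ℕ → ℕ → ℤ → ℂ} {n : ℤ}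
    {j : ℕ} (h0 : 1 ≤ j) (hj : j < level1 ρ φ b n) (hφ : fourierCoeff (φ j) n ≠ 0) :
    maskEnergy ρ b j n = 0 := by
  by_contra h
  exact Nat.notMem_of_lt_sInf hj ⟨⟨h0, hφ⟩, h0, h⟩

theorem one_le_level1 {ρ : ℕ → ℕ} {φ : ℕ → L2} {b : ℕ → ℕ → ℤ → ℂ} {n : ℤ}
    (hn : (activeLevels ρ φ b n).Nonempty) : 1 ≤ level1 ρ φ b n :=
  (Nat.sInf_mem hn).1.1

theorem maskEnergy_level1_pos {ρ : ℕ → ℕ} {φ : ℕ → L2} {b : ℕ → ℕ → ℤ → ℂ} {n : ℤ}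
    (hn : (activeLevels ρ φ b n).Nonempty) :
    0 < maskEnergy ρ b (level1 ρ φ b n) n :=
  lt_of_le_of_ne (maskEnergy_nonneg _ _ _ _) (Ne.symm (Nat.sInf_mem hn).2.2)

namespace RefinementSystem

variable {ρ : ℕ → ℕ} {φ : ℕ → L2} {ψ : ℕ → ℕ → L2} {a : ℕ → ℤ → ℂ} {b : ℕ → ℕ → ℤ → ℂ}

theorem fourierCoeff_ne_zero_of_le (S : RefinementSystem ρ φ ψ a b) {j j' : ℕ} {n : ℤ}
    (h0 : 1 ≤ j) (h : fourierCoeff (φ j) n ≠ 0) (hj : j ≤ j') : fourierCoeff (φ j') n ≠ 0 := by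
  induction j', hj using Nat.le_induction with
  | base => exact h
  | succ j' hj ih =>
    rw [S.refine_φ j' (by omega)] at ih
    exact right_ne_zero_of_mul ih

theorem theta_mul_norm_sq_eq_zero (S : RefinementSystem ρ φ ψ a b) {j : ℕ} {n : ℤ}
    (hj : j < level1 ρ φ b n) (hφ : fourierCoeff (φ (j + 1)) n ≠ 0) :
    theta ρ a b j n * ‖a (j + 1) n‖ ^ 2 = 0 := by
  induction j with
  | zero => simp [theta]
  | succ j ih =>
    by_cases ha : a (j + 1 + 1) n = 0
    · simp [ha]
    · have h1 : fourierCoeff (φ (j + 1)) n ≠ 0 := by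
        rw [S.refine_φ (j + 1) (by omega)]
        exact mul_ne_zero (mul_ne_zero (by simp) ha) hφ
      rw [theta_eq_zero_iff.2 ⟨maskEnergy_eq_zero_of_lt_level1 (by omega) hj h1,
        ih (by omega) h1⟩, zero_mul]

/-- Up to the level `j_1(n)` the low-pass part of the mask product at `n` vanishes. -/
theorem maskProduct_eq_sum (S : RefinementSystem ρ φ ψ a b) {j : ℕ} {n : ℤ} (n' : ℤ)
    (hj : j < level1 ρ φ b n) (hφ : fourierCoeff (φ (j + 1)) n ≠ 0) :
    maskProduct ρ a b j n n' = ∑ m ∈ Icc 1 (ρ j), conj (b (j + 1) m n) * b (j + 1) m n' := by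
  unfold maskProduct
  rcases mul_eq_zero.1 (S.theta_mul_norm_sq_eq_zero hj hφ) with h | h
  · simp [h]
  · have : a (j + 1) n = 0 := by simpa using h
    simp [this]

section Active

variable {n : ℤ}

theorem fourierCoeff_ne_zero (S : RefinementSystem ρ φ ψ a b)
    (hn : (activeLevels ρ φ b n).Nonempty) {j : ℕ} (hj : level1 ρ φ b n ≤ j) :
    fourierCoeff (φ j) n ≠ 0 :=
  S.fourierCoeff_ne_zero_of_le (one_le_level1 hn) (Nat.sInf_mem hn).1.2 hj

theorem a_ne_zero (S : RefinementSystem ρ φ ψ a b)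
    (hn : (activeLevels ρ φ b n).Nonempty) {j : ℕ} (hj : level1 ρ φ b n ≤ j) :
    a (j + 1) n ≠ 0 := by
  have h := S.fourierCoeff_ne_zero hn hj
  rw [S.refine_φ j ((one_le_level1 hn).trans hj)] at h
  exact right_ne_zero_of_mul (left_ne_zero_of_mul h)

theorem theta_level1 (S : RefinementSystem ρ φ ψ a b)
    (hn : (activeLevels ρ φ b n).Nonempty) :
    theta ρ a b (level1 ρ φ b n) n = maskEnergy ρ b (level1 ρ φ b n) n := by
  obtain ⟨j, hj⟩ := Nat.exists_eq_add_of_le' (one_le_level1 hn)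
  have h := S.fourierCoeff_ne_zero hn le_rfl
  rw [hj] at h ⊢
  rw [theta, S.theta_mul_norm_sq_eq_zero (by omega) h, add_zero]

theorem theta_pos (S : RefinementSystem ρ φ ψ a b)
    (hn : (activeLevels ρ φ b n).Nonempty) {j : ℕ} (hj : level1 ρ φ b n ≤ j) :
    0 < theta ρ a b j n := by
  induction j, hj using Nat.le_induction with
  | base => rw [S.theta_level1 hn]; exact maskEnergy_level1_pos hn
  | succ j hj ih =>
    have := norm_pos_iff.2 (S.a_ne_zero hn hj)
    have := maskEnergy_nonneg ρ b (j + 1) n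
    rw [theta]
    positivity

theorem norm_fourierCoeff_level1 (S : RefinementSystem ρ φ ψ a b)
    (hn : (activeLevels ρ φ b n).Nonempty) {N : ℕ} (hN : level1 ρ φ b n ≤ N) :
    2 ^ level1 ρ φ b n * ‖fourierCoeff (φ (level1 ρ φ b n)) n‖ ^ 2 =
      2 ^ N * ‖fourierCoeff (φ N) n‖ ^ 2 * ∏ r ∈ Ioc (level1 ρ φ b n) N, ‖a r n‖ ^ 2 := by
  induction N, hN using Nat.le_induction with
  | base => simp
  | succ N hN ih =>
    rw [ih, prod_Ioc_succ_top hN, S.refine_φ N ((one_le_level1 hn).trans hN), norm_mul, norm_mul,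
      Complex.norm_real, Real.norm_eq_abs, mul_pow, mul_pow, sq_abs,
      Real.sq_sqrt (by norm_num : (0 : ℝ) ≤ 2)]
    ring

/-! ### Parameters representing the masks -/

theorem aTilde_eq_of_represents {t : ℕ → ℤ → ℕ → ℝ} (h : RepresentsMasks ρ φ a b t n) {j : ℕ}
    (hj : level1 ρ φ b n ≤ j) : aTilde ρ t (j + 1) n =
      √(theta ρ a b j n) * a (j + 1) n / √(theta ρ a b (j + 1) n) := by
  rw [aTilde_eq_sphericalVector, h j hj 0 (by omega), unitMask, if_pos rfl]

theorem norm_aTilde_of_represents (S : RefinementSystem ρ φ ψ a b)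
    (hn : (activeLevels ρ φ b n).Nonempty) {t : ℕ → ℤ → ℕ → ℝ}
    (h : RepresentsMasks ρ φ a b t n) {j : ℕ}
    (hj : level1 ρ φ b n ≤ j) :
    √(theta ρ a b (j + 1) n) * ‖aTilde ρ t (j + 1) n‖ = √(theta ρ a b j n) * ‖a (j + 1) n‖ := by
  have h2 := Real.sqrt_pos.2 (S.theta_pos hn (hj.trans j.le_succ))
  rw [aTilde_eq_of_represents h hj, norm_div, norm_mul, Complex.norm_real, Complex.norm_real,
    Real.norm_of_nonneg (Real.sqrt_nonneg _), Real.norm_of_nonneg (Real.sqrt_nonneg _)]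
  field_simp

theorem aligned_of_represents (S : RefinementSystem ρ φ ψ a b)
    (hn : (activeLevels ρ φ b n).Nonempty) {t : ℕ → ℤ → ℕ → ℝ}
    (h : RepresentsMasks ρ φ a b t n) {j : ℕ} (hj : level1 ρ φ b n ≤ j) :
    aTilde ρ t (j + 1) n ≠ 0 ∧ ∃ c : ℝ, 0 < c ∧ aTilde ρ t (j + 1) n = (c : ℂ) * a (j + 1) n := by
  have h1 := Real.sqrt_pos.2 (S.theta_pos hn hj)
  have h2 := Real.sqrt_pos.2 (S.theta_pos hn (hj.trans j.le_succ))
  have h3 : aTilde ρ t (j + 1) n =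
      ((√(theta ρ a b j n) / √(theta ρ a b (j + 1) n) : ℝ) : ℂ) * a (j + 1) n := by
    rw [aTilde_eq_of_represents h hj]
    push_cast
    ring
  refine ⟨?_, _, by positivity, h3⟩
  rw [h3]
  exact mul_ne_zero (by exact_mod_cast (by positivity)) (S.a_ne_zero hn hj)

theorem sqrt_theta_of_represents (S : RefinementSystem ρ φ ψ a b)
    (hn : (activeLevels ρ φ b n).Nonempty) {t : ℕ → ℤ → ℕ → ℝ}
    (h : RepresentsMasks ρ φ a b t n) {N : ℕ} (hN : level1 ρ φ b n ≤ N) :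
    √(theta ρ a b N n) = √(maskEnergy ρ b (level1 ρ φ b n) n) *
      ∏ r ∈ Ioc (level1 ρ φ b n) N, ‖a r n‖ / ‖aTilde ρ t r n‖ := by
  induction N, hN using Nat.le_induction with
  | base => simp [S.theta_level1 hn]
  | succ N hN ih =>
    have h1 := norm_pos_iff.2 (aligned_of_represents S hn h hN).1
    rw [prod_Ioc_succ_top hN, ← mul_assoc, ← ih, ← mul_div_assoc,
      ← norm_aTilde_of_represents S hn h hN]
    field_simp

theorem mask_formula_of_represents (S : RefinementSystem ρ φ ψ a b)
    (hn : (activeLevels ρ φ b n).Nonempty) {t : ℕ → ℤ → ℕ → ℝ}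
    (h : RepresentsMasks ρ φ a b t n) {j m : ℕ} (hj : level1 ρ φ b n ≤ j) (hm : m ∈ Icc 1 (ρ j)) :
    b (j + 1) m n = bTilde ρ t (j + 1) m n * ((√(maskEnergy ρ b (level1 ρ φ b n) n) *
        ∏ r ∈ Ioc (level1 ρ φ b n) (j + 1), ‖a r n‖ / ‖aTilde ρ t r n‖ : ℝ) : ℂ) := by
  have h2 := Real.sqrt_pos.2 (S.theta_pos hn (hj.trans j.le_succ))
  have hm' := mem_Icc.1 hm
  rw [← sqrt_theta_of_represents S hn h (hj.trans j.le_succ), bTilde_eq_sphericalVector,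
    h j hj m hm'.2, unitMask, if_neg (by omega), div_mul_cancel₀]
  exact_mod_cast h2.ne'

/-- The alignment condition and the formula for the masks determine the fundamental
coefficients, and hence force the parameters to represent the normalised mask vectors. -/
theorem representsMasks_of_formula (S : RefinementSystem ρ φ ψ a b)
    (hn : (activeLevels ρ φ b n).Nonempty) {t : ℕ → ℤ → ℕ → ℝ}
    (ha : ∀ j, level1 ρ φ b n ≤ j → aTilde ρ t (j + 1) n ≠ 0 ∧
      ∃ c : ℝ, 0 < c ∧ aTilde ρ t (j + 1) n = (c : ℂ) * a (j + 1) n)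
    (hb : ∀ j, level1 ρ φ b n ≤ j → ∀ m ∈ Icc 1 (ρ j), b (j + 1) m n =
      bTilde ρ t (j + 1) m n * ((√(maskEnergy ρ b (level1 ρ φ b n) n) *
        ∏ r ∈ Ioc (level1 ρ φ b n) (j + 1), ‖a r n‖ / ‖aTilde ρ t r n‖ : ℝ) : ℂ)) :
    RepresentsMasks ρ φ a b t n := by
  set G : ℕ → ℝ := fun N => √(maskEnergy ρ b (level1 ρ φ b n) n) *
    ∏ r ∈ Ioc (level1 ρ φ b n) N, ‖a r n‖ / ‖aTilde ρ t r n‖ with hG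
  have hGnonneg : ∀ N, 0 ≤ G N := fun N => by positivity
  have hstep : ∀ j, level1 ρ φ b n ≤ j →
      G (j + 1) * ‖aTilde ρ t (j + 1) n‖ = G j * ‖a (j + 1) n‖ := by
    intro j hj
    have h1 := norm_pos_iff.2 (ha j hj).1
    simp only [hG]
    rw [prod_Ioc_succ_top hj]
    field_simp
  have htheta : ∀ N, level1 ρ φ b n ≤ N → theta ρ a b N n = G N ^ 2 := by
    intro N hN
    induction N, hN using Nat.le_induction with
    | base =>
      simp [hG, S.theta_level1 hn, Real.sq_sqrt (maskEnergy_nonneg _ _ _ _)]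
    | succ N hN ih =>
      have hE : maskEnergy ρ b (N + 1) n =
          (∑ m ∈ Icc 1 (ρ N), ‖sphericalVector (ρ N) (t (N + 1) n) m‖ ^ 2) * G (N + 1) ^ 2 := by
        rw [maskEnergy, sum_mul]
        refine sum_congr rfl fun m hm => ?_
        rw [hb N hN m hm, norm_mul, mul_pow, Complex.norm_real, Real.norm_eq_abs, sq_abs,
          bTilde_eq_sphericalVector]
      have h1 := sum_norm_sq_sphericalVector (ρ N) (t (N + 1) n)
      rw [sum_Icc_zero, ← aTilde_eq_sphericalVector] at h1
      have h2 := hstep N hN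
      rw [theta, hE, ih]
      linear_combination G (N + 1) ^ 2 * h1 -
        (G (N + 1) * ‖aTilde ρ t (N + 1) n‖ + G N * ‖a (N + 1) n‖) * h2
  have hsqrt : ∀ N, level1 ρ φ b n ≤ N → √(theta ρ a b N n) = G N := fun N hN => by
    rw [htheta N hN, Real.sqrt_sq (hGnonneg N)]
  intro j hj m hm
  have hG1 : (G (j + 1) : ℂ) ≠ 0 := by
    have := Real.sqrt_pos.2 (S.theta_pos hn (hj.trans j.le_succ))
    rw [hsqrt _ (hj.trans j.le_succ)] at this
    exact_mod_cast this.ne'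
  rw [unitMask, hsqrt j hj, hsqrt _ (hj.trans j.le_succ), eq_div_iff hG1]
  split_ifs with h0
  · subst h0
    obtain ⟨-, c, hc, hac⟩ := ha j hj
    have h1 := hstep j hj
    have h2 : G (j + 1) * c = G j := by
      have h3 := norm_pos_iff.2 (S.a_ne_zero hn hj)
      rw [hac, norm_mul, Complex.norm_real, Real.norm_of_nonneg hc.le, ← mul_assoc] at h1
      exact mul_right_cancel₀ h3.ne' h1
    rw [← aTilde_eq_sphericalVector, hac, ← h2]
    push_cast
    ring
  · rw [hb j hj m (mem_Icc.2 ⟨by omega, hm⟩), bTilde_eq_sphericalVector]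

/-- For representing parameters the infinite product condition is the normalisation
`2^J θ_J |φ̂_J|² → 1`. -/
theorem productCondition_iff_of_represents (S : RefinementSystem ρ φ ψ a b)
    (hn : (activeLevels ρ φ b n).Nonempty) {t : ℕ → ℤ → ℕ → ℝ}
    (h : RepresentsMasks ρ φ a b t n) :
    ProductCondition ρ φ b t n ↔
      Tendsto (fun J => 2 ^ J * theta ρ a b J n * ‖fourierCoeff (φ J) n‖ ^ 2) atTop (𝓝 1) := by
  unfold ProductCondition
  set j₁ := level1 ρ φ b n with hj₁
  set K : ℝ := 2 ^ j₁ * maskEnergy ρ b j₁ n * ‖fourierCoeff (φ j₁) n‖ ^ 2 with hK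
  have hφ₁ := norm_pos_iff.2 (S.fourierCoeff_ne_zero hn le_rfl)
  have hE : 0 < maskEnergy ρ b j₁ n := maskEnergy_level1_pos hn
  have hK0 : 0 < K := by positivity
  have hprod : ∀ N, j₁ ≤ N → (∏ r ∈ Ioc j₁ N, ‖aTilde ρ t r n‖ ^ 2) *
      (2 ^ N * theta ρ a b N n * ‖fourierCoeff (φ N) n‖ ^ 2) = K := by
    intro N hN
    have h1 := S.norm_fourierCoeff_level1 hn hN
    have h2 := congrArg (· ^ 2) (sqrt_theta_of_represents S hn h hN)
    simp only [mul_pow, Real.sq_sqrt (S.theta_pos hn hN).le, ← hj₁, Real.sq_sqrt hE.le,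
      ← prod_pow, div_pow, prod_div_distrib] at h1 h2
    have h3 : 0 < ∏ r ∈ Ioc j₁ N, ‖aTilde ρ t r n‖ ^ 2 := by
      refine prod_pos fun r hr => ?_
      rw [mem_Ioc] at hr
      obtain ⟨j, rfl⟩ := Nat.exists_eq_add_of_lt (Nat.zero_lt_of_lt hr.1)
      rw [zero_add]
      have := norm_pos_iff.2 (aligned_of_represents S hn h (j := j) (by omega)).1
      positivity
    rw [h2, hK]
    field_simp
    linear_combination -h1
  have hquot : ∀ᶠ N in atTop, 2 ^ N * theta ρ a b N n * ‖fourierCoeff (φ N) n‖ ^ 2 =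
      K * (∏ r ∈ Ioc j₁ N, ‖aTilde ρ t r n‖ ^ 2)⁻¹ ∧
      (∏ r ∈ Ioc j₁ N, ‖aTilde ρ t r n‖ ^ 2) =
        K * (2 ^ N * theta ρ a b N n * ‖fourierCoeff (φ N) n‖ ^ 2)⁻¹ := by
    filter_upwards [eventually_ge_atTop j₁] with N hN
    have h1 := hprod N hN
    have h2 : (∏ r ∈ Ioc j₁ N, ‖aTilde ρ t r n‖ ^ 2) ≠ 0 := by
      intro h3; rw [h3, zero_mul] at h1; exact hK0.ne h1
    have h3 : 2 ^ N * theta ρ a b N n * ‖fourierCoeff (φ N) n‖ ^ 2 ≠ 0 := by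
      intro h3; rw [h3, mul_zero] at h1; exact hK0.ne h1
    exact ⟨by rw [← h1]; field_simp, by rw [← h1, mul_inv_cancel_right₀ h3]⟩
  constructor
  · intro h1
    have h2 := (h1.inv₀ hK0.ne').const_mul K
    rw [mul_inv_cancel₀ hK0.ne'] at h2
    exact h2.congr' (hquot.mono fun N hN => hN.1.symm)
  · intro h1
    have h2 := (h1.inv₀ one_ne_zero).const_mul K
    rw [inv_one, mul_one] at h2
    exact h2.congr' (hquot.mono fun N hN => hN.2.symm)

end Active

end RefinementSystem

/-! ### Linking the parameters at `n` and `n + 2^j` -/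

theorem dvd_pow_mul_odd_sub (j : ℕ) {k : ℤ} (hk : Odd k) (n : ℤ) :
    (2 : ℤ) ^ (j + 1) ∣ n + 2 ^ j * k - (n + 2 ^ j) := by
  obtain ⟨l, rfl⟩ := hk
  exact ⟨l, by ring⟩

namespace RefinementSystem

variable {ρ : ℕ → ℕ} {φ : ℕ → L2} {ψ : ℕ → ℕ → L2} {a : ℕ → ℤ → ℂ} {b : ℕ → ℕ → ℤ → ℂ}

theorem unitMask_congr (S : RefinementSystem ρ φ ψ a b) {j m : ℕ} (hj : 1 ≤ j) (hm : m ≤ ρ j)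
    {n n' : ℤ} (h : (2 : ℤ) ^ (j + 1) ∣ n' - n) :
    unitMask ρ a b j n' m = unitMask ρ a b j n m := by
  unfold unitMask
  rw [S.theta_congr h, S.theta_congr ((pow_dvd_pow 2 (by omega)).trans h), S.a_congr hj h]
  split_ifs with h0
  · rfl
  · rw [S.b_congr (mem_Icc.2 ⟨by omega, hm⟩) h]

theorem sum_conj_unitMask_mul (S : RefinementSystem ρ φ ψ a b) {j : ℕ} {n n' : ℤ}
    (h : (2 : ℤ) ^ j ∣ n' - n) :
    ∑ m ∈ Icc 0 (ρ j), conj (unitMask ρ a b j n m) * unitMask ρ a b j n' m =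
      maskProduct ρ a b j n n' / (√(theta ρ a b (j + 1) n) * √(theta ρ a b (j + 1) n')) := by
  have hsq : ((√(theta ρ a b j n) : ℝ) : ℂ) * (√(theta ρ a b j n) : ℝ) = theta ρ a b j n := by
    rw [← Complex.ofReal_mul, Real.mul_self_sqrt (theta_nonneg _ _ _ _ _)]
  rw [sum_Icc_zero, maskProduct, add_comm, add_div, sum_div]
  congr 1
  · refine sum_congr rfl fun m hm => ?_
    have hm0 : m ≠ 0 := by have := (mem_Icc.1 hm).1; omega
    simp only [unitMask, if_neg hm0, map_div₀, Complex.conj_ofReal]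
    rw [div_mul_div_comm]
  · simp only [unitMask, if_true, map_div₀, map_mul, Complex.conj_ofReal, S.theta_congr h]
    rw [div_mul_div_comm, ← hsq]
    ring

theorem sum_norm_sq_unitMask (S : RefinementSystem ρ φ ψ a b) {j : ℕ} {n : ℤ}
    (h : 0 < theta ρ a b (j + 1) n) : ∑ m ∈ Icc 0 (ρ j), ‖unitMask ρ a b j n m‖ ^ 2 = 1 := by
  have h1 := S.sum_conj_unitMask_mul (j := j) (n := n) (n' := n) (by simp)
  rw [maskProduct_self, ← Complex.ofReal_mul, Real.mul_self_sqrt h.le, div_self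
    (by exact_mod_cast h.ne')] at h1
  simp only [Complex.conj_mul'] at h1
  exact_mod_cast h1

/-- Orthogonality of the mask vectors seen by the scaling functions suffices to choose periodic
parameters that represent the masks and are linked at all levels. A residue class modulo
`2^{j+1}` that contains no `n'` with `j_1(n') ≤ j` imposes no condition on its parameters. -/
theorem exists_linked_parameters (S : RefinementSystem ρ φ ψ a b) (hρ : ∀ j, 0 < ρ j)
    (hne : ∀ n, (activeLevels ρ φ b n).Nonempty)
    (hA : ∀ (j : ℕ) (n k : ℤ), Odd k → fourierCoeff (φ (j + 1)) n ≠ 0 →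
        fourierCoeff (φ (j + 1)) (n + 2 ^ j * k) ≠ 0 →
          maskProduct ρ a b j n (n + 2 ^ j * k) = 0) :
    ∃ t : ℕ → ℤ → ℕ → ℝ,
      (∀ j, 1 ≤ j → Function.Periodic (t (j + 1)) ((2 : ℤ) ^ (j + 1))) ∧
      (∀ n, RepresentsMasks ρ φ a b t n) ∧
      ∀ j, 1 ≤ j → ∀ n, LinkingSystem (ρ j) (t (j + 1) n) (t (j + 1) (n + 2 ^ j)) := by
  let active : ℕ → ℤ → Prop := fun j n =>
    ∃ n', (2 : ℤ) ^ (j + 1) ∣ n' - n ∧ level1 ρ φ b n' ≤ j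
  have hactive : ∀ j n n', (2 : ℤ) ^ (j + 1) ∣ n' - n → active j n' → active j n := by
    rintro j n n' h ⟨n'', h1, h2⟩
    exact ⟨n'', by simpa using h1.add h, h2⟩
  have hunit : ∀ j n, active j n → ∑ m ∈ Icc 0 (ρ j), ‖unitMask ρ a b j n m‖ ^ 2 = 1 := by
    rintro j n ⟨n', h1, h2⟩
    refine S.sum_norm_sq_unitMask ?_
    rw [← S.theta_congr h1]
    exact S.theta_pos (hne n') (h2.trans j.le_succ)
  have horth : ∀ j n, active j n → active j (n + 2 ^ j) →
      ∑ m ∈ Icc 0 (ρ j), conj (unitMask ρ a b j n m) * unitMask ρ a b j (n + 2 ^ j) m = 0 := by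
    rintro j n ⟨n₁, h1, h1'⟩ ⟨n₂, h2, h2'⟩
    obtain ⟨k₁, hk₁⟩ := h1
    obtain ⟨k₂, hk₂⟩ := h2
    have h3 : n₂ = n₁ + 2 ^ j * (2 * (k₂ - k₁) + 1) := by
      rw [pow_succ] at hk₁ hk₂
      linear_combination hk₂ - hk₁
    have h4 := hA j n₁ (2 * (k₂ - k₁) + 1) ⟨_, rfl⟩
      (S.fourierCoeff_ne_zero (hne n₁) (h1'.trans j.le_succ))
      (by rw [← h3]; exact S.fourierCoeff_ne_zero (hne n₂) (h2'.trans j.le_succ))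
    rw [← h3, S.maskProduct_congr (n := n) (l := n + 2 ^ j) ⟨k₁, hk₁⟩ ⟨k₂, hk₂⟩] at h4
    rw [S.sum_conj_unitMask_mul (by simp), h4, zero_div]
  have hlevel : ∀ j, 1 ≤ j → ∃ t : ℤ → ℕ → ℝ, Function.Periodic t ((2 : ℤ) ^ (j + 1)) ∧
      (∀ n, active j n → ∀ m ≤ ρ j, sphericalVector (ρ j) (t n) m = unitMask ρ a b j n m) ∧
      ∀ n, LinkingSystem (ρ j) (t n) (t (n + 2 ^ j)) := by
    intro j hj
    rw [pow_succ']
    refine exists_periodic_pairing (by positivity)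
      (fun n s => active j n → ∀ m ≤ ρ j, sphericalVector (ρ j) s m = unitMask ρ a b j n m)
      (LinkingSystem (ρ j)) (fun _ _ h => h.symm) (fun n n' s h hs hact m hm => ?_) fun n => ?_
    · rw [← pow_succ'] at h
      rw [S.unitMask_congr hj hm h, hs (hactive j n n' h hact) m hm]
    · exact exists_linked (hρ j) _ _ _ _ (hunit j n) (hunit j _) (horth j n)
  choose! t ht using hlevel
  refine ⟨fun j => t (j - 1), fun j hj => (ht j hj).1, fun n j hj m hm => ?_,
    fun j hj => (ht j hj).2.2⟩
  exact (ht j ((one_le_level1 (hne n)).trans hj)).2.1 n ⟨n, by simp, hj⟩ m hm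

/-- At the levels up to `j_1(n)`, vanishing of the masks and their orthogonality at `j_1(n)` give
orthogonality of the mask vectors. -/
theorem maskProduct_eq_zero_of_lt_level1 (S : RefinementSystem ρ φ ψ a b)
    {t : ℕ → ℤ → ℕ → ℝ} {j : ℕ} {n k : ℤ} (hM : MaskCondition ρ φ a b t n) (hk : Odd k)
    (hj : j < level1 ρ φ b n) (h1 : fourierCoeff (φ (j + 1)) n ≠ 0)
    (h2 : fourierCoeff (φ (j + 1)) (n + 2 ^ j * k) ≠ 0) :
    maskProduct ρ a b j n (n + 2 ^ j * k) = 0 := by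
  rw [S.maskProduct_congr (n := n) (l := n + 2 ^ j) (by simp) (dvd_pow_mul_odd_sub j hk n),
    S.maskProduct_eq_sum _ hj h1]
  rcases Nat.lt_or_ge (j + 1) (level1 ρ φ b n) with h | h
  · refine sum_eq_zero fun m hm => ?_
    have h3 := maskEnergy_eq_zero_of_lt_level1 (by omega) h h1
    rw [maskEnergy_eq_zero_iff.1 h3 m hm, map_zero, zero_mul]
  · have h4 : level1 ρ φ b n = j + 1 := by omega
    have h5 := hM.orthogonal
    rw [h4] at h5
    exact h5 ⟨k, hk, h2⟩

/-- Above `j_1`, the linking equations say that the mask vectors are orthogonal. -/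
theorem maskProduct_eq_zero_of_linked (S : RefinementSystem ρ φ ψ a b)
    {t : ℕ → ℤ → ℕ → ℝ} {j : ℕ} {n n' : ℤ} (hn : (activeLevels ρ φ b n).Nonempty)
    (hn' : (activeLevels ρ φ b n').Nonempty) (ht : RepresentsMasks ρ φ a b t n)
    (ht' : RepresentsMasks ρ φ a b t n') (hd : (2 : ℤ) ^ j ∣ n' - n)
    (hj : level1 ρ φ b n ≤ j) (hj' : level1 ρ φ b n' ≤ j)
    (hL : LinkingSystem (ρ j) (t (j + 1) n) (t (j + 1) n')) : maskProduct ρ a b j n n' = 0 := by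
  have h1 := (linkingSystem_iff _ _ _).1 hL
  rw [sum_congr rfl fun m hm => by
    rw [ht j hj m (mem_Icc.1 hm).2, ht' j hj' m (mem_Icc.1 hm).2],
    S.sum_conj_unitMask_mul hd] at h1
  have h2 := Real.sqrt_pos.2 (S.theta_pos hn (hj.trans j.le_succ))
  have h3 := Real.sqrt_pos.2 (S.theta_pos hn' (hj'.trans j.le_succ))
  refine (div_eq_zero_iff.1 h1).resolve_right (mul_ne_zero ?_ ?_)
  · exact_mod_cast h2.ne'
  · exact_mod_cast h3.ne'

/-- If `2^J θ_J(n) |φ̂_J(n)|² → 1`, some level is active at `n`: otherwise `θ_J(n) φ̂_J(n)` would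
vanish for all `J`. -/
theorem activeLevels_nonempty (S : RefinementSystem ρ φ ψ a b) {n : ℤ}
    (h : Tendsto (fun J => 2 ^ J * theta ρ a b J n * ‖fourierCoeff (φ J) n‖ ^ 2) atTop (𝓝 1)) :
    (activeLevels ρ φ b n).Nonempty := by
  by_contra hne
  have hzero : ∀ J, theta ρ a b J n * ‖fourierCoeff (φ J) n‖ ^ 2 = 0 := by
    intro J
    induction J with
    | zero => simp [theta]
    | succ J ih =>
      by_cases h1 : fourierCoeff (φ (J + 1)) n = 0
      · simp [h1]
      · have h2 : maskEnergy ρ b (J + 1) n = 0 := by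
          by_contra h2
          exact hne ⟨J + 1, ⟨by omega, h1⟩, by omega, h2⟩
        have h3 : theta ρ a b (J + 1) n = 0 := by
          refine theta_eq_zero_iff.2 ⟨h2, ?_⟩
          rcases J with _ | J
          · simp [theta]
          · rw [S.refine_φ (J + 1) (by omega)] at ih
            simpa [h1] using ih
        rw [h3, zero_mul]
  have h0 : (fun J => 2 ^ J * theta ρ a b J n * ‖fourierCoeff (φ J) n‖ ^ 2) = fun _ => (0 : ℝ) := by
    funext J
    rw [mul_assoc, hzero, mul_zero]
  rw [h0] at h
  exact zero_ne_one (tendsto_nhds_unique tendsto_const_nhds h)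

/-! ### The characterisation by parameters -/

theorem isParsevalWaveletFrame_iff_exists_parameters (S : RefinementSystem ρ φ ψ a b)
    (hρ : ∀ j, 0 < ρ j) :
    IsParsevalWaveletFrame ρ ψ ↔
      (∀ n : ℤ, (activeLevels ρ φ b n).Nonempty) ∧
      ∃ t : ℕ → ℤ → ℕ → ℝ, AdmissibleParameters ρ φ a b t ∧
        ∀ n : ℤ, ProductCondition ρ φ b t n ∧ MaskCondition ρ φ a b t n := by
  rw [S.isParsevalWaveletFrame_iff]
  constructor
  · rintro ⟨hA, hB⟩
    have hne : ∀ n, (activeLevels ρ φ b n).Nonempty := fun n => S.activeLevels_nonempty (hB n)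
    obtain ⟨t, hper, hrep, hlink⟩ := S.exists_linked_parameters hρ hne hA
    refine ⟨hne, t, ⟨fun j hj => ?_, fun j hj n _ _ => ?_, fun n j hj hj2 => ?_⟩,
      fun n => ⟨(S.productCondition_iff_of_represents (hne n) (hrep n)).2 (hB n), ?_, ?_, ?_⟩⟩
    · obtain ⟨i, rfl⟩ := Nat.exists_eq_add_of_le' (Nat.one_le_of_lt hj)
      exact hper i (by omega)
    · obtain ⟨i, rfl⟩ := Nat.exists_eq_add_of_le' (Nat.one_le_of_lt hj)
      exact hlink i (by omega) n
    · obtain ⟨i, rfl⟩ := Nat.exists_eq_add_of_le' (Nat.one_le_of_lt hj2)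
      exact S.aligned_of_represents (hne n) (hrep n) (by omega)
    · intro j hj0 hj1
      have h0 : fourierCoeff (φ (level0 φ n + 1)) n ≠ 0 := by
        obtain ⟨i, hi⟩ := Nat.exists_eq_add_of_le' (one_le_level1 (hne n))
        exact Nat.sInf_mem (s := {j : ℕ | fourierCoeff (φ (j + 1)) n ≠ 0})
          ⟨i, by rw [Set.mem_ofPred_eq, ← hi]; exact S.fourierCoeff_ne_zero (hne n) le_rfl⟩
      exact maskEnergy_eq_zero_iff.1 (maskEnergy_eq_zero_of_lt_level1 (by omega) hj1
        (S.fourierCoeff_ne_zero_of_le (by omega) h0 hj0))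
    · rintro ⟨k, hk, h2⟩
      have h1 := S.fourierCoeff_ne_zero (hne n) le_rfl
      obtain ⟨j, hj⟩ := Nat.exists_eq_add_of_le' (one_le_level1 (hne n))
      rw [hj] at h1 h2 ⊢
      rw [Nat.add_sub_cancel] at h2 ⊢
      rw [← S.maskProduct_eq_sum _ (by omega) h1, ← S.maskProduct_congr (n' := n)
        (l' := n + 2 ^ j * k) (by simp) (dvd_pow_mul_odd_sub j hk n)]
      exact hA j n k hk h1 h2
    · intro j hj m hm
      obtain ⟨i, rfl⟩ := Nat.exists_eq_add_of_lt (Nat.zero_lt_of_lt hj)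
      rw [zero_add] at hj hm ⊢
      exact S.mask_formula_of_represents (hne n) (hrep n) (by omega) hm
  · rintro ⟨hne, t, ht, hPM⟩
    have hrep : ∀ n, RepresentsMasks ρ φ a b t n := fun n =>
      S.representsMasks_of_formula (hne n)
        (fun j hj => ht.aligned n (j + 1) (by omega)
          (by have := one_le_level1 (hne n); omega))
        fun j hj m hm => (hPM n).2.formula (j + 1) (by omega) m hm
    refine ⟨fun j n k hk h1 h2 => ?_,
      fun n => (S.productCondition_iff_of_represents (hne n) (hrep n)).1 (hPM n).1⟩
    rcases Nat.lt_or_ge j (level1 ρ φ b n) with h | h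
    · exact S.maskProduct_eq_zero_of_lt_level1 (hPM n).2 hk h h1 h2
    have hd : (2 : ℤ) ^ j ∣ n + 2 ^ j * k - n := by simp
    rcases Nat.lt_or_ge j (level1 ρ φ b (n + 2 ^ j * k)) with h' | h'
    · have hback : n + 2 ^ j * k + 2 ^ j * (-k) = n := by ring
      have h3 := S.maskProduct_eq_zero_of_lt_level1 (hPM _).2 hk.neg h' h2 (by rwa [hback])
      rw [hback, ← S.conj_maskProduct hd] at h3
      simpa using h3
    · have hj : 1 ≤ j := (one_le_level1 (hne n)).trans h
      have hlift := dvd_pow_mul_odd_sub j hk n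
      refine S.maskProduct_eq_zero_of_linked (hne _) (hne _) (hrep _) (hrep _) hd h h' ?_
      rw [eq_of_dvd_of_periodic (ht.periodic (j + 1) (by omega)) hlift]
      refine ht.linked (j + 1) (by omega) n (S.theta_pos (hne n) (h.trans j.le_succ)).ne' ?_
      rw [Nat.add_sub_cancel, ← S.theta_congr hlift]
      exact (S.theta_pos (hne _) (h'.trans j.le_succ)).ne'

end RefinementSystem

end PeriodicWavelet

theorem theorem4
    (ρ : ℕ → ℕ) (hρ : ∀ j, 0 < ρ j)
    (φ : ℕ → PeriodicWavelet.L2) (ψ : ℕ → ℕ → PeriodicWavelet.L2)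
    (a : ℕ → ℤ → ℂ) (b : ℕ → ℕ → ℤ → ℂ)
    (ha : ∀ j : ℕ, 1 ≤ j → Function.Periodic (a (j + 1)) ((2 : ℤ) ^ (j + 1)))
    (hb : ∀ j : ℕ, ∀ m ∈ Finset.Icc 1 (ρ j),
      Function.Periodic (b (j + 1) m) ((2 : ℤ) ^ (j + 1)))
    (hφ : ∀ j : ℕ, 1 ≤ j → ∀ n : ℤ,
      fourierCoeff (φ j) n = (√2 : ℝ) * a (j + 1) n * fourierCoeff (φ (j + 1)) n)
    (hψ : ∀ j : ℕ, ∀ m ∈ Finset.Icc 1 (ρ j), ∀ n : ℤ,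
      fourierCoeff (ψ j m) n = (√2 : ℝ) * b (j + 1) m n * fourierCoeff (φ (j + 1)) n) :
    PeriodicWavelet.IsParsevalWaveletFrame ρ ψ ↔
      (∀ n : ℤ, (PeriodicWavelet.activeLevels ρ φ b n).Nonempty) ∧
      ∃ t : ℕ → ℤ → ℕ → ℝ, PeriodicWavelet.AdmissibleParameters ρ φ a b t ∧
        ∀ n : ℤ, PeriodicWavelet.ProductCondition ρ φ b t n ∧
          PeriodicWavelet.MaskCondition ρ φ a b t n :=
  PeriodicWavelet.RefinementSystem.isParsevalWaveletFrame_iff_exists_parameters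
    ⟨ha, hb, hφ, hψ⟩ hρ
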